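/- Let $p,q$ be coprime positive integers, $c=c_{p,q}=1-\frac{6(p-q)^2}{pq}$ and $h_{k,l}=\frac{(lp-kq)^2-(p-q)^2}{4pq}$. Let $0<k,r<p$, $0<l,s<q$ and $h\in\mathbb{C}$. Denote by $L^c_{h'}$ the irreducible highest weight module of the Virasoro algebra of central charge $c$ and highest weight $h'$, regarded as a module, with $T=L_{-1}$, over the universal Virasoro vertex algebra $\mathrm{Vir}^c$. Let $\mathcal{Y}(a,z)b=\sum_{n\in\mathbb{C}}a_{(n)}b\,z^{-n-1}$ be an intertwining operator of type $\binom{L^c_h}{L^c_{h_{k,l}}\ \ L^c_{h_{r,s}}}$, and let $[a_\lambda b]=\sum_{n\in\mathbb{C}}\lambda^{(n)}a_{(n)}b$, where $\lambda^{(n)}=\lambda^n/\Gamma(n+1)$ (so $\lambda^{(n)}=0$ for $n\in\mathbb{Z}_{<0}$). Let $a\in L^c_{h_{k,l}}$ be a highest weight vector. Say that $b\in L^c_{h_{r,s}}$ has level at most $N$ ($N\in\mathbb{Z}_{\ge0}$) if it is a sum of eigenvectors of $L_0$ with eigenvalues $h_{r,s}+i$, $0\le i\le N$. Then every $b\in L^c_{h_{r,s}}$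 has level at most $N$ for some $N$. If $b$ has level at most $N$, then, with $$m=-h+(h_{r,s}+N)+h_{k,l}-1,$$ for every integer $j\ge-1$ there are vectors $d_n\in L^c_h$ ($n\ge 0$) such that $$[a_\lambda L_{-j-2}b]=\lambda^{(m+j+2)}\bigl((j+1)h_{k,l}+(m+1)\bigr)a_{(m)}b+\sum_{n\ge0}\lambda^{(m+j+1-n)}d_n .$$ In particular, for a highest weight vector $b$ (so $N=0$) this holds with $m=-h+h_{r,s}+h_{k,l}-1$. -/

import Mathlib

/-- The underlying space `⨁ ℂ L_n ⊕ ℂ C` of the Virasoro algebra. -/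
def Vir : Type := (ℤ →₀ ℂ) × ℂ

namespace Vir

noncomputable instance : AddCommGroup Vir := inferInstanceAs (AddCommGroup ((ℤ →₀ ℂ) × ℂ))

noncomputable instance : Module ℂ Vir := inferInstanceAs (Module ℂ ((ℤ →₀ ℂ) × ℂ))

/-- The generator `L_n`. -/
noncomputable def L (n : ℤ) : Vir := (Finsupp.single n 1, 0)

/-- The central element `C`. -/
noncomputable def C : Vir := (0, 1)

/-- The bilinear map with
`(L_m, L_n) ↦ (m - n) L_{m+n} + δ_{m,-n} (m³ - m)/12 C`. -/
noncomputable def wittBracket : (ℤ →₀ ℂ) →ₗ[ℂ] (ℤ →₀ ℂ) →ₗ[ℂ] Vir :=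
  Finsupp.lsum ℂ fun m => LinearMap.toSpanSingleton ℂ _ (Finsupp.lsum ℂ fun n =>
    LinearMap.toSpanSingleton ℂ Vir
      (((m : ℂ) - n) • L (m + n) + (if m = -n then ((m : ℂ) ^ 3 - m) / 12 else 0) • C))

/-- The Virasoro bracket; `C` is central. -/
noncomputable instance : Bracket Vir Vir := ⟨fun x y => wittBracket x.1 y.1⟩

theorem bracket_def (x y : Vir) : ⁅x, y⁆ = wittBracket x.1 y.1 := rfl

theorem wittBracket_single (m n : ℤ) (s t : ℂ) :
    wittBracket (Finsupp.single m s) (Finsupp.single n t) = (s * t) •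
      (((m : ℂ) - n) • L (m + n) + (if m = -n then ((m : ℂ) ^ 3 - m) / 12 else 0) • C) := by
  simp [wittBracket, smul_smul, mul_assoc]

@[simp] theorem zero_fst : (0 : Vir).1 = 0 := rfl
@[simp] theorem add_fst (x y : Vir) : (x + y).1 = x.1 + y.1 := rfl
@[simp] theorem smul_fst (s : ℂ) (x : Vir) : (s • x).1 = s • x.1 := rfl
@[simp] theorem L_fst (n : ℤ) : (L n).1 = Finsupp.single n 1 := rfl
@[simp] theorem C_fst : C.1 = 0 := rfl

theorem wittBracket_skew (x y : ℤ →₀ ℂ) : wittBracket x y = - wittBracket y x := by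
  induction x using Finsupp.induction_linear with
  | zero => simp
  | add f g hf hg => simp [hf, hg]; abel
  | single m s =>
    induction y using Finsupp.induction_linear with
    | zero => simp
    | add f g hf hg => simp [hf, hg]; abel
    | single n t =>
      rw [wittBracket_single, wittBracket_single, add_comm n m, mul_comm t s, ← smul_neg]
      congr 1
      rw [neg_add, ← neg_smul, ← neg_smul]
      congr 2
      · ring
      · by_cases h : m = -n
        · subst h; simp; ring
        · have : n ≠ -m := by omega
          simp [h, this]

theorem wittBracket_self (x : ℤ →₀ ℂ) : wittBracket x x = 0 := by
  have h := wittBracket_skew x x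
  rw [eq_neg_iff_add_eq_zero, ← two_smul ℂ] at h
  exact (smul_eq_zero.mp h).resolve_left two_ne_zero

theorem wittBracket_jacobi (x y z : ℤ →₀ ℂ) :
    wittBracket x (wittBracket y z).1 =
      wittBracket (wittBracket x y).1 z + wittBracket y (wittBracket x z).1 := by
  induction x using Finsupp.induction_linear with
  | zero => simp
  | add f g hf hg => simp [hf, hg]; abel
  | single l r =>
    induction y using Finsupp.induction_linear with
    | zero => simp
    | add f g hf hg => simp [hf, hg]; abel
    | single m s =>
      induction z using Finsupp.induction_linear with
      | zero => simp
      | add f g hf hg => simp [hf, hg]; abel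
      | single n t =>
        simp only [wittBracket_single, smul_fst, add_fst, L_fst, C_fst, smul_zero, add_zero,
          map_smul, LinearMap.smul_apply, smul_smul, smul_add, mul_one]
        rw [show l + (m + n) = l + m + n by ring, show m + (l + n) = l + m + n by ring]
        rw [add_add_add_comm, ← add_smul, ← add_smul]
        congr 2
        · push_cast; ring
        · by_cases h : l = -(m + n)
          · have h1 : l + m = -n := by omega
            have h2 : m = -(l + n) := by omega
            rw [if_pos h, if_pos h1, if_pos h2, h]
            push_cast; ring
          · have h1 : l + m ≠ -n := by omega
            have h2 : m ≠ -(l + n) := by omega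
            rw [if_neg h, if_neg h1, if_neg h2]; ring

noncomputable instance : LieRing Vir where
  add_lie x y z := by simp [bracket_def]
  lie_add x y z := by simp [bracket_def]
  lie_self x := wittBracket_self _
  leibniz_lie x y z := wittBracket_jacobi _ _ _

noncomputable instance : LieAlgebra ℂ Vir where
  lie_smul t x y := by simp [bracket_def]

theorem lie_L_L (m n : ℤ) : ⁅L m, L n⁆ =
    ((m : ℂ) - n) • L (m + n) + (if m = -n then ((m : ℂ) ^ 3 - m) / 12 else 0) • C := by
  simp [bracket_def, wittBracket_single]

theorem lie_L_C (m : ℤ) : ⁅L m, C⁆ = 0 := by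
  simp [bracket_def]

theorem mem_of_generators (P : Submodule ℂ Vir) (hL : ∀ n, L n ∈ P) (hC : C ∈ P) (x : Vir) :
    x ∈ P := by
  have h1 : ∀ f : ℤ →₀ ℂ, LinearMap.inl ℂ (ℤ →₀ ℂ) ℂ f ∈ (P : Submodule ℂ ((ℤ →₀ ℂ) × ℂ)) := by
    intro f
    induction f using Finsupp.induction_linear with
    | zero => rw [map_zero]; exact P.zero_mem
    | add f g hf hg => rw [map_add]; exact P.add_mem hf hg
    | single n t =>
      have := P.smul_mem t (hL n)
      rw [← mul_one t, ← smul_eq_mul, ← Finsupp.smul_single, map_smul]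
      exact this
  have h2 : ∀ t : ℂ, LinearMap.inr ℂ (ℤ →₀ ℂ) ℂ t ∈ (P : Submodule ℂ ((ℤ →₀ ℂ) × ℂ)) := by
    intro t
    rw [← mul_one t, ← smul_eq_mul, map_smul]
    exact P.smul_mem t hC
  have h3 := P.add_mem (h1 x.1) (h2 x.2)
  have h4 : (LinearMap.inl ℂ (ℤ →₀ ℂ) ℂ x.1 + LinearMap.inr ℂ (ℤ →₀ ℂ) ℂ x.2) = x := by
    apply Prod.ext <;> simp
  exact h4 ▸ h3

end Vir

/-- The universal enveloping algebra of the Virasoro algebra. -/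
abbrev UVir : Type := UniversalEnvelopingAlgebra ℂ Vir

namespace UVir

attribute [local instance] LieRing.ofAssociativeRing

/-- The image of `L_n` in `U(Vir)`. -/
noncomputable def L (n : ℤ) : UVir := UniversalEnvelopingAlgebra.ι ℂ (Vir.L n)

/-- The image of `C` in `U(Vir)`. -/
noncomputable def C : UVir := UniversalEnvelopingAlgebra.ι ℂ Vir.C

theorem L_mul_L (m n : ℤ) : L m * L n = L n * L m +
    (((m : ℂ) - n) • L (m + n) + (if m = -n then ((m : ℂ) ^ 3 - m) / 12 else 0) • C) := by
  have h := LieHom.map_lie (UniversalEnvelopingAlgebra.ι ℂ) (Vir.L m) (Vir.L n)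
  rw [Vir.lie_L_L, map_add, map_smul, map_smul, LieRing.of_associative_ring_bracket] at h
  rw [← sub_eq_iff_eq_add']
  exact h.symm

theorem L_mul_C (m : ℤ) : L m * C = C * L m := by
  have h := LieHom.map_lie (UniversalEnvelopingAlgebra.ι ℂ) (Vir.L m) Vir.C
  rw [Vir.lie_L_C, map_zero, LieRing.of_associative_ring_bracket] at h
  exact (sub_eq_zero.mp h.symm)

/-- A property of elements of a `U(Vir)`-module that is stable under sums, scalars and all
`L_n`, `C` is stable under `U(Vir)`. -/
theorem smul_mem_of_stable {M : Type*} [AddCommGroup M] [Module ℂ M] [Module UVir M]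
    [IsScalarTower ℂ UVir M] (W : Submodule ℂ M) (hL : ∀ n, ∀ x ∈ W, L n • x ∈ W)
    (hC : ∀ x ∈ W, C • x ∈ W) (u : UVir) : ∀ x ∈ W, u • x ∈ W := by
  have hι : ∀ y : Vir, ∀ x ∈ W, UniversalEnvelopingAlgebra.ι ℂ y • x ∈ W := by
    intro y x hx
    let P : Submodule ℂ Vir := W.comap
      ((LinearMap.toSpanSingleton UVir M x).restrictScalars ℂ ∘ₗ
        (UniversalEnvelopingAlgebra.ι ℂ : Vir →ₗ⁅ℂ⁆ UVir).toLinearMap)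
    exact Vir.mem_of_generators P (fun n => hL n x hx) (hC x hx) y
  obtain ⟨u, rfl⟩ := (RingCon.mk'_surjective (UniversalEnvelopingAlgebra.ringCon ℂ Vir)) u
  change ∀ x ∈ W, UniversalEnvelopingAlgebra.mkAlgHom ℂ Vir u • x ∈ W
  induction u using TensorAlgebra.induction with
  | algebraMap r =>
    intro x hx
    rw [AlgHom.commutes, algebraMap_smul]; exact W.smul_mem _ hx
  | ι y => exact hι y
  | mul a b ha hb =>
    intro x hx
    rw [map_mul, mul_smul]; exact ha _ (hb _ hx)
  | add a b ha hb =>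
    intro x hx
    rw [map_add, add_smul]; exact W.add_mem (ha _ hx) (hb _ hx)

end UVir

/-- The induced module `U(Vir) ⊗_{U(⨁_{n ≥ -1} ℂ L_n ⊕ ℂ C)} ℂ_c`, on which `C` acts by `c` on the
generator and `L_n`, `n ≥ -1`, kill the generator, written as a quotient of `U(Vir)` by a left
ideal. This is the underlying space of the universal Virasoro vertex algebra. -/
abbrev VirC (c : ℂ) : Type :=
  UVir ⧸ Submodule.span UVir
    ({UVir.C - algebraMap ℂ UVir c} ∪ {u | ∃ n : ℤ, -1 ≤ n ∧ u = UVir.L n})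

/-- The vacuum vector of `VirC c`. -/
noncomputable def VirC.vac (c : ℂ) : VirC c := Submodule.Quotient.mk 1

/-- The Verma module `U(Vir) ⊗_{U(⨁_{n ≥ 0} ℂ L_n ⊕ ℂ C)} ℂ m` with `C m = c m`, `L_0 m = h m` and
`L_n m = 0` for `n ≥ 1`, written as a quotient of `U(Vir)` by a left ideal. -/
abbrev Verma (c h : ℂ) : Type :=
  UVir ⧸ Submodule.span UVir
    ({UVir.C - algebraMap ℂ UVir c} ∪ {UVir.L 0 - algebraMap ℂ UVir h} ∪
      {u | ∃ n : ℤ, 1 ≤ n ∧ u = UVir.L n})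

/-- The maximal proper submodule of the Verma module: the sum of all its proper submodules. -/
noncomputable def Verma.maxSubmodule (c h : ℂ) : Submodule UVir (Verma c h) :=
  sSup {N | N ≠ ⊤}

/-- The irreducible highest weight module `L^c_h`. -/
abbrev IrrMod (c h : ℂ) : Type := Verma c h ⧸ Verma.maxSubmodule c h

/-- The image in `L^c_h` of the generator of the Verma module. -/
noncomputable def IrrMod.gen (c h : ℂ) : IrrMod c h :=
  Submodule.Quotient.mk (Submodule.Quotient.mk 1)

section Modules

variable (M : Type*) [AddCommGroup M] [Module ℂ M] [Module UVir M] [IsScalarTower ℂ UVir M]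

/-- The action of `L_n` on a `U(Vir)`-module. -/
noncomputable def virOp (n : ℤ) : Module.End ℂ M := Algebra.lsmul ℂ ℂ M (UVir.L n)

/-- A Virasoro module of central charge `c` such that, for every `w`, `L_n w = 0` for all
sufficiently large `n` (so that `L(z) w` is a formal Laurent series). -/
class IsSmoothVir (c : ℂ) : Prop where
  central : ∀ w : M, UVir.C • w = c • w
  smooth : ∀ w : M, ∃ N : ℤ, ∀ n ≥ N, virOp M n w = 0

variable {M}

theorem virOp_apply (n : ℤ) (w : M) : virOp M n w = UVir.L n • w := rfl

theorem virOp_comm {c : ℂ} [IsSmoothVir M c] (m n : ℤ) (w : M) :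
    virOp M m (virOp M n w) = virOp M n (virOp M m w) + (((m : ℂ) - n) • virOp M (m + n) w +
      (if m = -n then ((m : ℂ) ^ 3 - m) / 12 * c else 0) • w) := by
  simp only [virOp_apply, ← mul_smul]
  rw [UVir.L_mul_L]
  simp only [add_smul, smul_assoc, IsSmoothVir.central (c := c)]
  split_ifs <;> simp [smul_smul]

/-- A module generated by a vector that is killed by almost all `L_n`, `n ≥ 0`, and on which `C`
acts by `c`, is smooth. -/
theorem isSmoothVir_of_generator {c : ℂ} (v : M) (hv : ∀ w : M, ∃ u : UVir, w = u • v)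
    (hC : UVir.C • v = c • v) (hL : ∃ N : ℤ, ∀ n ≥ N, UVir.L n • v = 0) : IsSmoothVir M c := by
  have hcen : ∀ w : M, UVir.C • w = c • w := by
    let W : Submodule ℂ M :=
      LinearMap.ker (Algebra.lsmul ℂ ℂ M (UVir.C - algebraMap ℂ UVir c))
    have hW : ∀ x, x ∈ W ↔ UVir.C • x = c • x := by
      intro x
      change (UVir.C - algebraMap ℂ UVir c) • x = 0 ↔ _
      rw [sub_smul, algebraMap_smul, sub_eq_zero]
    intro w
    obtain ⟨u, rfl⟩ := hv w
    rw [← hW]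
    refine UVir.smul_mem_of_stable W ?_ ?_ u v ((hW v).2 hC)
    · intro n x hx
      rw [hW] at hx ⊢
      rw [← mul_smul, ← UVir.L_mul_C, mul_smul, hx, smul_comm]
    · intro x hx
      rw [hW] at hx ⊢
      rw [hx, smul_comm, hx]
  refine ⟨hcen, ?_⟩
  let W : Submodule ℂ M :=
    { carrier := {w | ∃ N : ℤ, ∀ n ≥ N, UVir.L n • w = 0}
      zero_mem' := ⟨0, fun n _ => smul_zero _⟩
      add_mem' := by
        rintro a b ⟨N, hN⟩ ⟨K, hK⟩
        refine ⟨max N K, fun n hn => ?_⟩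
        rw [smul_add, hN n (le_trans (le_max_left _ _) hn),
          hK n (le_trans (le_max_right _ _) hn), add_zero]
      smul_mem' := by
        rintro s a ⟨N, hN⟩
        refine ⟨N, fun n hn => ?_⟩
        rw [smul_comm, hN n hn, smul_zero] }
  intro w
  obtain ⟨u, rfl⟩ := hv w
  refine UVir.smul_mem_of_stable W ?_ ?_ u v hL
  · rintro k x ⟨N, hN⟩
    refine ⟨max (max N (N - k)) (-k + 1), fun n hn => ?_⟩
    have h1 : N ≤ n := by omega
    have h2 : N ≤ n + k := by omega
    have h3 : ¬ n = -k := by omega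
    rw [← mul_smul, UVir.L_mul_L, if_neg h3, zero_smul, add_zero, add_smul, mul_smul, hN n h1,
      smul_zero, zero_add, smul_assoc, hN _ h2, smul_zero]
  · intro x hx
    rw [hcen]
    exact W.smul_mem _ hx

end Modules

instance (c h : ℂ) : IsSmoothVir (IrrMod c h) c := by
  have key : ∀ u : UVir, u ∈ Submodule.span UVir
      ({UVir.C - algebraMap ℂ UVir c} ∪ {UVir.L 0 - algebraMap ℂ UVir h} ∪
        {u | ∃ n : ℤ, 1 ≤ n ∧ u = UVir.L n}) → u • IrrMod.gen c h = 0 := by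
    intro u hu
    change Submodule.Quotient.mk (Submodule.Quotient.mk (u • 1)) = 0
    rw [smul_eq_mul, mul_one, (Submodule.Quotient.mk_eq_zero _).2 hu]
    rfl
  refine isSmoothVir_of_generator (IrrMod.gen c h) ?_ ?_ ⟨1, fun n hn => ?_⟩
  · intro w
    obtain ⟨w, rfl⟩ := Submodule.Quotient.mk_surjective _ w
    obtain ⟨u, rfl⟩ := Submodule.Quotient.mk_surjective _ w
    refine ⟨u, ?_⟩
    change _ = Submodule.Quotient.mk (Submodule.Quotient.mk (u • 1))
    rw [smul_eq_mul, mul_one]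
  · have := key _ (Submodule.subset_span (Or.inl (Or.inl rfl)))
    rwa [sub_smul, algebraMap_smul, sub_eq_zero] at this
  · exact key _ (Submodule.subset_span (Or.inr ⟨n, hn, rfl⟩))

section FormalSums

variable {E : Type*} [AddCommGroup E]

theorem finsum_eq_range {g : ℕ → E} {N : ℕ} (h : ∀ j, N ≤ j → g j = 0) :
    ∑ᶠ j, g j = ∑ j ∈ Finset.range N, g j := by
  apply finsum_eq_sum_of_support_subset
  intro j hj
  by_contra hj'
  exact hj (h j (by simpa using hj'))

theorem finite_support_of_bound {g : ℕ → E} {N : ℕ} (h : ∀ j, N ≤ j → g j = 0) :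
    (Function.support g).Finite :=
  (Finset.range N).finite_toSet.subset fun j hj => by
    by_contra hj'
    exact hj (h j (by simpa using hj'))

theorem finsum_finsum_comm {g : ℕ → ℕ → E} {N : ℕ} (h1 : ∀ i j, N ≤ i → g i j = 0)
    (h2 : ∀ i j, N ≤ j → g i j = 0) : ∑ᶠ i, ∑ᶠ j, g i j = ∑ᶠ j, ∑ᶠ i, g i j := by
  rw [finsum_eq_range (N := N), finsum_eq_range (N := N)]
  · simp_rw [fun i => finsum_eq_range (h2 i), fun j => finsum_eq_range fun i => h1 i j]
    exact Finset.sum_comm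
  · intro j hj; simp [h2 _ j hj]
  · intro i hi; simp [h1 i _ hi]

theorem finsum_finsum_antidiagonal {g : ℕ → ℕ → E} {N : ℕ} (h : ∀ i j, N ≤ i + j → g i j = 0) :
    ∑ᶠ i, ∑ᶠ j, g i j = ∑ᶠ s, ∑ x ∈ Finset.HasAntidiagonal.antidiagonal s, g x.1 x.2 := by
  have h1 : ∀ i j, N ≤ i → g i j = 0 := fun i j hi => h i j (by omega)
  have h2 : ∀ i j, N ≤ j → g i j = 0 := fun i j hi => h i j (by omega)
  rw [finsum_eq_range (N := N), finsum_eq_range (N := N)]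
  · simp_rw [fun i => finsum_eq_range (h2 i)]
    rw [← Finset.sum_product', ← Finset.sum_biUnion]
    · symm
      apply Finset.sum_subset
      · intro x hx
        simp at hx ⊢
        omega
      · intro x _ hx
        apply h
        by_contra hlt
        exact hx (by simp; omega)
    · intro a _ b _ hab
      rw [Function.onFun, Finset.disjoint_left]
      intro x hx hx'
      simp at hx hx'
      exact hab (by omega)
  · intro s hs
    exact Finset.sum_eq_zero fun x hx => h _ _ (by simp at hx; omega)
  · intro i hi; simp [h1 i _ hi]

end FormalSums

/-- The binomial coefficient `binom(n, j)`, `n ∈ ℤ`, as a complex number. -/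
noncomputable def binomC (n : ℤ) (j : ℕ) : ℂ := ((Ring.choose n j : ℤ) : ℂ)

section Binomials

theorem binomC_zero_right (n : ℤ) : binomC n 0 = 1 := by simp [binomC]

theorem binomC_zero_left (j : ℕ) (hj : j ≠ 0) : binomC 0 j = 0 := by
  simp [binomC, Ring.choose_zero_pos ℤ (Nat.pos_of_ne_zero hj)]

theorem binomC_pred_self (s : ℕ) (hs : s ≠ 0) : binomC ((s : ℤ) - 1) s = 0 := by
  obtain ⟨t, rfl⟩ := Nat.exists_eq_succ_of_ne_zero hs
  have : (((t.succ : ℕ) : ℤ) - 1) = ((t : ℕ) : ℤ) := by push_cast; ring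
  rw [this, binomC, Ring.choose_natCast, Nat.choose_eq_zero_of_lt (Nat.lt_succ_self t)]
  simp

theorem binomC_vandermonde (m n : ℤ) (s : ℕ) :
    ∑ x ∈ Finset.HasAntidiagonal.antidiagonal s, binomC m x.1 * binomC n x.2 = binomC (m + n) s := by
  rw [binomC, Ring.add_choose_eq s (Commute.all m n)]
  push_cast
  rfl

theorem succ_mul_binomC (n : ℤ) (i : ℕ) :
    ((i : ℂ) + 1) * binomC n (i + 1) = n * binomC (n - 1) i := by
  have h1 := Ring.descPochhammer_eq_factorial_smul_choose n (i + 1)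
  have h2 := Ring.descPochhammer_eq_factorial_smul_choose (n - 1) i
  rw [descPochhammer_succ_left, Polynomial.smeval_X_mul, Polynomial.smeval_comp] at h1
  simp only [Polynomial.smeval_sub, Polynomial.smeval_X, Polynomial.smeval_one, pow_one,
    pow_zero, one_smul] at h1
  rw [h2, nsmul_eq_mul, nsmul_eq_mul, Nat.factorial_succ] at h1
  have h3 : (((i : ℤ) + 1) * Ring.choose n (i + 1) : ℤ) = n * Ring.choose (n - 1) i := by
    have hf : ((i.factorial : ℕ) : ℤ) ≠ 0 := by exact_mod_cast i.factorial_ne_zero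
    apply mul_left_cancel₀ hf
    push_cast at h1
    linear_combination -h1
  simp only [binomC]
  exact_mod_cast h3

theorem sub_mul_binomC (n : ℤ) (i : ℕ) :
    ((n : ℂ) - i) * binomC n i = n * binomC (n - 1) i := by
  cases i with
  | zero => simp [binomC_zero_right]
  | succ i =>
    have h1 : binomC n (i + 1) = binomC (n - 1) i + binomC (n - 1) (i + 1) := by
      have := Ring.choose_succ_succ (n - 1) i
      rw [sub_add_cancel] at this
      simp only [binomC]
      exact_mod_cast this
    have h2 := succ_mul_binomC n i
    push_cast
    linear_combination (n : ℂ) * h1 - h2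

theorem binomC_pascal (n : ℤ) (s : ℕ) :
    binomC (n + 1) (s + 1) - binomC n (s + 1) = binomC n s := by
  have := Ring.choose_succ_succ n s
  simp only [binomC]
  rw [this]
  push_cast
  ring

theorem binomC_neg_one (j : ℕ) : binomC (-1) j = (-1) ^ j := by
  induction j with
  | zero => simp [binomC_zero_right]
  | succ j ih =>
    have h := binomC_pascal (-1) j
    rw [ih, neg_add_cancel, binomC_zero_left _ (Nat.succ_ne_zero j)] at h
    rw [pow_succ]
    linear_combination -h

end Binomials

section Fields

variable (M : Type*) [AddCommGroup M] [Module ℂ M]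

/-- The condition that, for every `w ∈ M`, `A_n w = 0` for all sufficiently large `n`. -/
def fieldSubmodule : Submodule ℂ (ℤ → Module.End ℂ M) where
  carrier := {A | ∀ w : M, ∃ N : ℤ, ∀ n ≥ N, A n w = 0}
  zero_mem' := fun _ => ⟨0, fun _ _ => rfl⟩
  add_mem' := by
    intro A B hA hB w
    obtain ⟨N, hN⟩ := hA w
    obtain ⟨K, hK⟩ := hB w
    refine ⟨max N K, fun n hn => ?_⟩
    rw [Pi.add_apply, LinearMap.add_apply, hN n (le_trans (le_max_left _ _) hn),
      hK n (le_trans (le_max_right _ _) hn), add_zero]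
  smul_mem' := by
    intro s A hA w
    obtain ⟨N, hN⟩ := hA w
    refine ⟨N, fun n hn => ?_⟩
    rw [Pi.smul_apply, LinearMap.smul_apply, hN n hn, smul_zero]

/-- The space `Hom(M, M((z)))` of formal fields `A(z) = ∑_{n ∈ ℤ} A_n z^{-n-1}`, given by their
modes: for every `w ∈ M`, `A_n w = 0` for all sufficiently large `n`. -/
abbrev FieldSpace : Type _ := fieldSubmodule M

variable {M}

/-- The pointwise finite sum `∑_{j ≥ 0} T_j` of operators. -/
noncomputable def finsumOp (T : ℕ → Module.End ℂ M)
    (hT : ∀ w, ∃ N : ℕ, ∀ j, N ≤ j → T j w = 0) : Module.End ℂ M where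
  toFun w := ∑ᶠ j, T j w
  map_add' x y := by
    obtain ⟨N, hN⟩ := hT x
    obtain ⟨K, hK⟩ := hT y
    simp only [map_add]
    exact finsum_add_distrib (finite_support_of_bound hN) (finite_support_of_bound hK)
  map_smul' s x := by
    simp only [map_smul, RingHom.id_apply]
    exact (smul_finsum s _).symm

namespace FieldSpace

/-- The `n`-th mode `A_n`. -/
def mode (A : FieldSpace M) (n : ℤ) : Module.End ℂ M := A.1 n

theorem exists_bound (A : FieldSpace M) (w : M) : ∃ N : ℤ, ∀ n ≥ N, A.mode n w = 0 := A.2 w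

theorem ext' {A B : FieldSpace M} (h : ∀ n w, A.mode n w = B.mode n w) : A = B :=
  Subtype.ext (funext fun n => LinearMap.ext (h n))

theorem mode_add (A B : FieldSpace M) (n : ℤ) (w : M) :
    (A + B).mode n w = A.mode n w + B.mode n w := rfl

theorem mode_smul (s : ℂ) (A : FieldSpace M) (n : ℤ) (w : M) :
    (s • A).mode n w = s • A.mode n w := rfl

/-- The identity field `I_M = I_M z^0`. -/
noncomputable def one : FieldSpace M :=
  ⟨fun n => if n = -1 then 1 else 0, fun w => ⟨0, fun n hn => by
    have : n ≠ -1 := by omega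
    simp [this]⟩⟩

/-- The summands of the `k`-th mode of the `n`-th product. -/
noncomputable def nthProductTerm (A B : FieldSpace M) (n k : ℤ) (j : ℕ) : Module.End ℂ M :=
  ((-1) ^ j * binomC n j) • (A.mode (n - j) * B.mode (k + j)
    - ((-1 : ℂ) ^ n) • (B.mode (n + k - j) * A.mode j))

theorem nthProductTerm_apply (A B : FieldSpace M) (n k : ℤ) (j : ℕ) (w : M) :
    nthProductTerm A B n k j w = ((-1) ^ j * binomC n j) • A.mode (n - j) (B.mode (k + j) w)
      - ((-1 : ℂ) ^ n * ((-1) ^ j * binomC n j)) • B.mode (n + k - j) (A.mode j w) := by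
  simp only [nthProductTerm, LinearMap.smul_apply, LinearMap.sub_apply, Module.End.mul_apply,
    smul_sub, smul_smul]
  congr 2
  ring

theorem left_bound (B : FieldSpace M) (w : M) (k : ℤ) :
    ∃ N : ℕ, ∀ j : ℕ, N ≤ j → B.mode (k + j) w = 0 := by
  obtain ⟨N, hN⟩ := B.exists_bound w
  exact ⟨(N - k).toNat, fun j hj => hN _ (by omega)⟩

theorem right_bound (A : FieldSpace M) (w : M) :
    ∃ N : ℕ, ∀ j : ℕ, N ≤ j → A.mode j w = 0 := by
  obtain ⟨N, hN⟩ := A.left_bound w 0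
  exact ⟨N, fun j hj => by simpa using hN j hj⟩

theorem nthProductTerm_bound (A B : FieldSpace M) (n k : ℤ) (w : M) :
    ∃ N : ℕ, ∀ j, N ≤ j → nthProductTerm A B n k j w = 0 := by
  obtain ⟨N, hN⟩ := B.left_bound w k
  obtain ⟨K, hK⟩ := A.right_bound w
  refine ⟨max N K, fun j hj => ?_⟩
  rw [nthProductTerm_apply, hN j (le_trans (le_max_left _ _) hj),
    hK j (le_trans (le_max_right _ _) hj)]
  simp

/-- The first half of the `n`-th product. -/
noncomputable def leftSum (A B : FieldSpace M) (n k : ℤ) (w : M) : M :=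
  ∑ᶠ j : ℕ, ((-1) ^ j * binomC n j) • A.mode (n - j) (B.mode (k + j) w)

/-- The second half of the `n`-th product. -/
noncomputable def rightSum (A B : FieldSpace M) (n k : ℤ) (w : M) : M :=
  ∑ᶠ j : ℕ, ((-1 : ℂ) ^ n * ((-1) ^ j * binomC n j)) • B.mode (n + k - j) (A.mode j w)

theorem finsum_nthProductTerm (A B : FieldSpace M) (n k : ℤ) (w : M) :
    ∑ᶠ j, nthProductTerm A B n k j w = leftSum A B n k w - rightSum A B n k w := by
  obtain ⟨N, hN⟩ := B.left_bound w k
  obtain ⟨K, hK⟩ := A.right_bound w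
  simp only [nthProductTerm_apply]
  apply finsum_sub_distrib
  · exact finite_support_of_bound (N := N) fun j hj => by rw [hN j hj]; simp
  · exact finite_support_of_bound (N := K) fun j hj => by rw [hK j hj]; simp

theorem exists_bound_range (N : ℕ) (P : ℕ → ℤ → Prop) (h : ∀ j, ∃ K : ℤ, ∀ k ≥ K, P j k) :
    ∃ K : ℤ, ∀ j < N, ∀ k ≥ K, P j k := by
  induction N with
  | zero => exact ⟨0, fun j hj => absurd hj (Nat.not_lt_zero j)⟩
  | succ N ih =>
    obtain ⟨K, hK⟩ := ih
    obtain ⟨K', hK'⟩ := h N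
    refine ⟨max K K', fun j hj k hk => ?_⟩
    rcases Nat.lt_succ_iff_lt_or_eq.mp hj with h1 | rfl
    · exact hK j h1 k (le_trans (le_max_left _ _) hk)
    · exact hK' k (le_trans (le_max_right _ _) hk)

theorem leftSum_bound (A B : FieldSpace M) (n : ℤ) (w : M) :
    ∃ N : ℤ, ∀ k ≥ N, leftSum A B n k w = 0 := by
  obtain ⟨N, hN⟩ := B.exists_bound w
  refine ⟨N, fun k hk => ?_⟩
  rw [leftSum, ← finsum_zero (α := ℕ)]
  exact finsum_congr fun j => by rw [hN _ (by omega)]; simp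

theorem rightSum_bound (A B : FieldSpace M) (n : ℤ) (w : M) :
    ∃ N : ℤ, ∀ k ≥ N, rightSum A B n k w = 0 := by
  obtain ⟨K, hK⟩ := A.right_bound w
  obtain ⟨N, hN⟩ := exists_bound_range K (fun j k => B.mode (n + k - j) (A.mode j w) = 0) (by
    intro j
    obtain ⟨N, hN⟩ := B.exists_bound (A.mode j w)
    exact ⟨N - n + j, fun k hk => hN _ (by omega)⟩)
  refine ⟨N, fun k hk => ?_⟩
  rw [rightSum, ← finsum_zero (α := ℕ)]
  refine finsum_congr fun j => ?_
  by_cases hj : j < K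
  · rw [hN j hj k hk, smul_zero]
  · rw [hK j (by omega), map_zero, smul_zero]

/-- The `n`-th product of fields, `n ∈ ℤ`:
`A(w)_(n) B(w) = Res_z (ι_{z,w} (z - w)^n A(z) B(w) - ι_{w,z} (z - w)^n B(w) A(z))`, that is,
`(A_(n) B)_k = ∑_{j ≥ 0} (-1)^j binom(n, j) (A_{n-j} B_{k+j} - (-1)^n B_{n+k-j} A_j)`.
For `n = -i - 1` it is the normally ordered product `:∂^{(i)} A(z) B(z):`. -/
noncomputable def nthProduct (A : FieldSpace M) (n : ℤ) : FieldSpace M →ₗ[ℂ] FieldSpace M where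
  toFun B := ⟨fun k => finsumOp (nthProductTerm A B n k) (nthProductTerm_bound A B n k), by
    intro w
    obtain ⟨N, hN⟩ := leftSum_bound A B n w
    obtain ⟨K, hK⟩ := rightSum_bound A B n w
    refine ⟨max N K, fun k hk => ?_⟩
    change ∑ᶠ j, nthProductTerm A B n k j w = 0
    rw [finsum_nthProductTerm, hN k (le_trans (le_max_left _ _) hk),
      hK k (le_trans (le_max_right _ _) hk), sub_zero]⟩
  map_add' B B' := by
    refine ext' fun k w => ?_
    obtain ⟨N, hN⟩ := nthProductTerm_bound A B n k w
    obtain ⟨K, hK⟩ := nthProductTerm_bound A B' n k w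
    change ∑ᶠ j, nthProductTerm A (B + B') n k j w =
      ∑ᶠ j, nthProductTerm A B n k j w + ∑ᶠ j, nthProductTerm A B' n k j w
    rw [← finsum_add_distrib (finite_support_of_bound hN) (finite_support_of_bound hK)]
    refine finsum_congr fun j => ?_
    simp only [nthProductTerm_apply, mode_add, map_add, smul_add]
    abel
  map_smul' s B := by
    refine ext' fun k w => ?_
    change ∑ᶠ j, nthProductTerm A (s • B) n k j w = s • ∑ᶠ j, nthProductTerm A B n k j w
    rw [smul_finsum]
    refine finsum_congr fun j => ?_
    simp only [nthProductTerm_apply, mode_smul, map_smul, smul_sub, smul_comm s]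

theorem nthProduct_mode (A B : FieldSpace M) (n k : ℤ) (w : M) :
    (nthProduct A n B).mode k w = leftSum A B n k w - rightSum A B n k w :=
  finsum_nthProductTerm A B n k w

/-- The first half of the `n`-th product, as a field. -/
noncomputable def leftField (A B : FieldSpace M) (n : ℤ) : FieldSpace M :=
  ⟨fun k => finsumOp (fun j => ((-1) ^ j * binomC n j) • (A.mode (n - j) * B.mode (k + j)))
    (fun w => by
      obtain ⟨N, hN⟩ := B.left_bound w k
      exact ⟨N, fun j hj => by simp [hN j hj]⟩), leftSum_bound A B n⟩

/-- The second half of the `n`-th product, as a field. -/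
noncomputable def rightField (A B : FieldSpace M) (n : ℤ) : FieldSpace M :=
  ⟨fun k => finsumOp (fun j => ((-1 : ℂ) ^ n * ((-1) ^ j * binomC n j)) •
      (B.mode (n + k - j) * A.mode j))
    (fun w => by
      obtain ⟨N, hN⟩ := A.right_bound w
      exact ⟨N, fun j hj => by simp [hN j hj]⟩), rightSum_bound A B n⟩

theorem leftField_mode (A B : FieldSpace M) (n k : ℤ) (w : M) :
    (leftField A B n).mode k w = leftSum A B n k w := rfl

theorem rightField_mode (A B : FieldSpace M) (n k : ℤ) (w : M) :
    (rightField A B n).mode k w = rightSum A B n k w := rfl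

theorem nthProduct_eq (A B : FieldSpace M) (n : ℤ) :
    nthProduct A n B = leftField A B n - rightField A B n :=
  ext' fun k w => nthProduct_mode A B n k w

theorem left_right_comm (A A' B : FieldSpace M) (m n : ℤ) :
    leftField A (rightField A' B n) m = rightField A' (leftField A B m) n := by
  refine ext' fun k w => ?_
  rw [leftField_mode, rightField_mode]
  simp only [leftSum, rightSum, rightField_mode, leftField_mode]
  obtain ⟨J, hJ⟩ := A'.right_bound w
  obtain ⟨I, hI⟩ := exists_bound_range J
    (fun j i => B.mode (n + (k + i) - j) (A'.mode j w) = 0) (by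
    intro j
    obtain ⟨N, hN⟩ := B.exists_bound (A'.mode j w)
    exact ⟨N - n - k + j, fun i hi => hN _ (by omega)⟩)
  have hz : ∀ (i j : ℕ), I.toNat + J ≤ i → B.mode (n + (k + i) - j) (A'.mode j w) = 0 := by
    intro i j hi
    by_cases hj : j < J
    · exact hI j hj i (by omega)
    · rw [hJ j (by omega), map_zero]
  have hz2 : ∀ (i j : ℕ), I.toNat + J ≤ j → B.mode (n + (k + i) - j) (A'.mode j w) = 0 := by
    intro i j hi
    rw [hJ j (by omega), map_zero]
  let g : ℕ → ℕ → M := fun i j => ((-1) ^ i * binomC m i * ((-1 : ℂ) ^ n * ((-1) ^ j * binomC n j))) •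
    A.mode (m - i) (B.mode (n + (k + i) - j) (A'.mode j w))
  have h1 : ∀ i : ℕ, ((-1 : ℂ) ^ i * binomC m i) • A.mode (m - i)
      (∑ᶠ j : ℕ, ((-1 : ℂ) ^ n * ((-1) ^ j * binomC n j)) •
        B.mode (n + (k + i) - j) (A'.mode j w)) = ∑ᶠ j, g i j := by
    intro i
    rw [finsum_eq_range (N := J) (fun j hj => by rw [hJ j hj]; simp),
      finsum_eq_range (N := J) (fun j hj => by simp only [g]; rw [hJ j hj]; simp),
      map_sum, Finset.smul_sum]
    simp only [map_smul, smul_smul, g]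
  have h2 : ∀ j : ℕ, ((-1 : ℂ) ^ n * ((-1) ^ j * binomC n j)) •
      ∑ᶠ i : ℕ, ((-1 : ℂ) ^ i * binomC m i) • A.mode (m - i)
        (B.mode (n + k - j + i) (A'.mode j w)) = ∑ᶠ i, g i j := by
    intro j
    rw [smul_finsum]
    refine finsum_congr fun i => ?_
    simp only [g, smul_smul]
    rw [show n + k - (j : ℤ) + i = n + (k + i) - j by ring]
    congr 1
    ring
  rw [finsum_congr h1, finsum_congr h2]
  refine finsum_finsum_comm (N := I.toNat + J) ?_ ?_
  · intro i j hi; simp only [g]; rw [hz i j hi]; simp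
  · intro i j hi; simp only [g]; rw [hz2 i j hi]; simp

theorem leftField_sub (A B B' : FieldSpace M) (n : ℤ) :
    leftField A (B - B') n = leftField A B n - leftField A B' n := by
  refine ext' fun k w => ?_
  obtain ⟨N, hN⟩ := B.left_bound w k
  obtain ⟨K, hK⟩ := B'.left_bound w k
  change leftSum A (B - B') n k w = leftSum A B n k w - leftSum A B' n k w
  simp only [leftSum]
  rw [← finsum_sub_distrib (finite_support_of_bound (N := N) fun j hj => by rw [hN j hj]; simp)
    (finite_support_of_bound (N := K) fun j hj => by rw [hK j hj]; simp)]
  refine finsum_congr fun j => ?_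
  rw [← smul_sub, ← map_sub]
  rfl

theorem rightField_sub (A B B' : FieldSpace M) (n : ℤ) :
    rightField A (B - B') n = rightField A B n - rightField A B' n := by
  refine ext' fun k w => ?_
  obtain ⟨N, hN⟩ := A.right_bound w
  change rightSum A (B - B') n k w = rightSum A B n k w - rightSum A B' n k w
  simp only [rightSum]
  rw [← finsum_sub_distrib (finite_support_of_bound (N := N) fun j hj => by rw [hN j hj]; simp)
    (finite_support_of_bound (N := N) fun j hj => by rw [hN j hj]; simp)]
  refine finsum_congr fun j => ?_
  rw [← smul_sub]
  rfl

theorem one_mode (n : ℤ) (w : M) : (one : FieldSpace M).mode n w = if n = -1 then w else 0 := by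
  change (if n = -1 then (1 : Module.End ℂ M) else 0) w = _
  split_ifs <;> rfl

/-- `A(z)_(n) I_M = 0` for `n ≥ 0`. -/
theorem nthProduct_one (A : FieldSpace M) (n : ℕ) : nthProduct A n one = 0 := by
  refine ext' fun k w => ?_
  rw [nthProduct_mode, leftSum, rightSum]
  change _ = 0
  rw [sub_eq_zero]
  simp only [one_mode]
  by_cases hk : k ≤ -1
  · obtain ⟨j, rfl⟩ : ∃ j : ℕ, k = -1 - j := ⟨(-1 - k).toNat, by omega⟩
    rw [finsum_eq_single _ j (fun i hi => by rw [if_neg (by omega), map_zero, smul_zero]),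
      if_pos (by omega)]
    by_cases hj : j ≤ n
    · rw [finsum_eq_single _ (n - j) (fun i hi => by rw [if_neg (by omega), smul_zero]),
        if_pos (by omega)]
      rw [show ((n - j : ℕ) : ℤ) = (n : ℤ) - j by push_cast [hj]; ring]
      congr 1
      have h1 : binomC n (n - j) = binomC n j := by
        simp only [binomC, Ring.choose_natCast, Nat.choose_symm hj]
      rw [h1, zpow_natCast, ← mul_assoc, ← pow_add, show n + (n - j) = j + 2 * (n - j) by omega,
        pow_add, pow_mul]
      norm_num
    · have h1 : binomC n j = 0 := by
        simp only [binomC, Ring.choose_natCast, Nat.choose_eq_zero_of_lt (not_le.mp hj)]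
        simp
      rw [h1, mul_zero, zero_smul]
      exact (finsum_eq_zero_of_forall_eq_zero fun i => by
        rw [if_neg (by omega), smul_zero]).symm
  · have hl : ∀ i : ℕ, ((-1 : ℂ) ^ i * binomC n i) •
        A.mode (n - i) (if k + i = -1 then w else 0) = 0 := fun i => by
      rw [if_neg (by omega), map_zero, smul_zero]
    have hr : ∀ i : ℕ, ((-1 : ℂ) ^ (n : ℤ) * ((-1) ^ i * binomC n i)) •
        (if (n : ℤ) + k - i = -1 then A.mode i w else 0) = 0 := fun i => by
      split_ifs with h
      · have h1 : binomC n i = 0 := by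
          simp only [binomC, Ring.choose_natCast, Nat.choose_eq_zero_of_lt (by omega : n < i)]
          simp
        rw [h1]; simp
      · rw [smul_zero]
    rw [finsum_congr hl, finsum_congr hr]

/-- `A(z)_(-1) I_M = A(z)`. -/
theorem nthProduct_neg_one_one (A : FieldSpace M) : nthProduct A (-1) one = A := by
  refine ext' fun k w => ?_
  have hsign : ∀ j : ℕ, (-1 : ℂ) ^ j * (-1) ^ j = 1 := fun j => by
    rw [← mul_pow]; simp
  rw [nthProduct_mode, leftSum, rightSum]
  simp only [one_mode, binomC_neg_one, hsign]
  by_cases hk : k ≤ -1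
  · obtain ⟨j, rfl⟩ : ∃ j : ℕ, k = -1 - j := ⟨(-1 - k).toNat, by omega⟩
    rw [finsum_eq_single _ j (fun i hi => by rw [if_neg (by omega), map_zero, smul_zero]),
      if_pos (by omega), finsum_eq_zero_of_forall_eq_zero fun i => by
        rw [if_neg (by omega), smul_zero], one_smul, sub_zero]
  · obtain ⟨j, rfl⟩ : ∃ j : ℕ, k = j := ⟨k.toNat, by omega⟩
    rw [finsum_eq_zero_of_forall_eq_zero fun i => by
        rw [if_neg (by omega), map_zero, smul_zero],
      finsum_eq_single _ j (fun i hi => by rw [if_neg (by omega), smul_zero]),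
      if_pos (by omega)]
    simp

end FieldSpace

end Fields

section VirasoroFields

theorem vandermonde_sub (m n : ℤ) (s : ℕ) :
    ∑ x ∈ Finset.HasAntidiagonal.antidiagonal s, binomC (m + 1) x.1 * binomC (n + 1) x.2 *
      (((m : ℂ) - x.1) - (n - x.2)) = ((m : ℂ) - n) * binomC (m + n + 1) s := by
  have h : ∀ x : ℕ × ℕ, binomC (m + 1) x.1 * binomC (n + 1) x.2 *
      (((m : ℂ) - x.1) - (n - x.2)) = ((m : ℂ) + 1) * (binomC m x.1 * binomC (n + 1) x.2)
        - ((n : ℂ) + 1) * (binomC (m + 1) x.1 * binomC n x.2) := by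
    intro x
    have h1 := sub_mul_binomC (m + 1) x.1
    have h2 := sub_mul_binomC (n + 1) x.2
    rw [add_sub_cancel_right] at h1 h2
    push_cast at h1 h2
    linear_combination binomC (n + 1) x.2 * h1 - binomC (m + 1) x.1 * h2
  rw [Finset.sum_congr rfl fun x _ => h x, Finset.sum_sub_distrib, ← Finset.mul_sum,
    ← Finset.mul_sum, binomC_vandermonde, binomC_vandermonde,
    show m + (n + 1) = m + n + 1 by ring, show m + 1 + n = m + n + 1 by ring]
  ring

theorem vandermonde_cube (m n : ℤ) (s : ℕ) :
    ∑ x ∈ Finset.HasAntidiagonal.antidiagonal s, binomC (m + 1) x.1 * binomC (n + 1) x.2 *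
      (((m : ℂ) - x.1) ^ 3 - (m - x.1)) = ((m : ℂ) ^ 3 - m) * binomC (m + n - 1) s := by
  have h : ∀ x : ℕ × ℕ, binomC (m + 1) x.1 * binomC (n + 1) x.2 *
      (((m : ℂ) - x.1) ^ 3 - (m - x.1)) =
        ((m : ℂ) ^ 3 - m) * (binomC (m - 2) x.1 * binomC (n + 1) x.2) := by
    intro x
    have h1 := sub_mul_binomC (m + 1) x.1
    have h2 := sub_mul_binomC m x.1
    have h3 := sub_mul_binomC (m - 1) x.1
    rw [add_sub_cancel_right] at h1
    rw [show m - 1 - 1 = m - 2 by ring] at h3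
    push_cast at h1 h2 h3
    linear_combination binomC (n + 1) x.2 * (((m : ℂ) - x.1) * (m - 1 - x.1) * h1 +
      (m + 1) * (m - 1 - x.1) * h2 + (m + 1) * m * h3)
  rw [Finset.sum_congr rfl fun x _ => h x, ← Finset.mul_sum, binomC_vandermonde,
    show m - 2 + (n + 1) = m + n - 1 by ring]

theorem vandermonde_index (m n : ℤ) (s : ℕ) :
    ∑ x ∈ Finset.HasAntidiagonal.antidiagonal s, binomC (m + 1) x.1 * binomC (n + 1) x.2 *
      ((x.2 : ℂ) - x.1) =
        - ((m : ℂ) - n) * (binomC (m + n + 2) s - binomC (m + n + 1) s) := by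
  have h : ∀ x : ℕ × ℕ, binomC (m + 1) x.1 * binomC (n + 1) x.2 * ((x.2 : ℂ) - x.1) =
      binomC (m + 1) x.1 * binomC (n + 1) x.2 * (((m : ℂ) - x.1) - (n - x.2)) -
        ((m : ℂ) - n) * (binomC (m + 1) x.1 * binomC (n + 1) x.2) := fun x => by ring
  rw [Finset.sum_congr rfl fun x _ => h x, Finset.sum_sub_distrib, ← Finset.mul_sum,
    vandermonde_sub, binomC_vandermonde, show m + 1 + (n + 1) = m + n + 2 by ring]
  ring

variable (M : Type*) [AddCommGroup M] [Module ℂ M] [Module UVir M] [IsScalarTower ℂ UVir M]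

/-- The Virasoro field `L(z) = ∑_n L_n z^{-n-2}` on a smooth module; its `n`-th mode (the
coefficient of `z^{-n-1}`) is `L_{n-1}`. -/
noncomputable def virField (c : ℂ) [IsSmoothVir M c] : FieldSpace M :=
  ⟨fun n => virOp M (n - 1), fun w => by
    obtain ⟨N, hN⟩ := IsSmoothVir.smooth c w
    exact ⟨N + 1, fun n hn => hN _ (by omega)⟩⟩

variable {M} {c : ℂ} [IsSmoothVir M c]

namespace FieldSpace

theorem virField_mode (n : ℤ) (w : M) : (virField M c).mode n w = virOp M (n - 1) w := rfl

theorem leftSum_leftField (B : FieldSpace M) (m n k : ℤ) (w : M) :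
    leftSum (virField M c) (leftField (virField M c) B (n + 1)) (m + 1) k w =
      ∑ᶠ s : ℕ, ∑ x ∈ Finset.HasAntidiagonal.antidiagonal s,
        ((-1 : ℂ) ^ s * (binomC (m + 1) x.1 * binomC (n + 1) x.2)) •
          virOp M (m - x.1) (virOp M (n - x.2) (B.mode (k + s) w)) := by
  obtain ⟨N, hN⟩ := B.left_bound w k
  let g : ℕ → ℕ → M := fun i j =>
    ((-1 : ℂ) ^ (i + j) * (binomC (m + 1) i * binomC (n + 1) j)) •
      virOp M (m - i) (virOp M (n - j) (B.mode (k + (i + j : ℕ)) w))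
  have hg : ∀ i j, N ≤ i + j → g i j = 0 := fun i j h => by
    simp only [g]; rw [hN _ h]; simp
  have h1 : leftSum (virField M c) (leftField (virField M c) B (n + 1)) (m + 1) k w =
      ∑ᶠ i, ∑ᶠ j, g i j := by
    rw [leftSum]
    refine finsum_congr fun i => ?_
    rw [leftField_mode, leftSum, virField_mode, finsum_eq_range (N := N),
      finsum_eq_range (N := N) (fun j hj => hg i j (by omega)), map_sum, Finset.smul_sum]
    · refine Finset.sum_congr rfl fun j _ => ?_
      simp only [g]
      rw [map_smul, smul_smul, virField_mode]
      rw [show m + 1 - (i : ℤ) - 1 = m - i by ring, show n + 1 - (j : ℤ) - 1 = n - j by ring,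
        show k + (i : ℤ) + j = k + (i + j : ℕ) by push_cast; ring]
      congr 1
      ring
    · intro j hj
      rw [show k + (i : ℤ) + j = k + (i + j : ℕ) by push_cast; ring, hN _ (by omega)]
      simp
  rw [h1, finsum_finsum_antidiagonal hg]
  refine finsum_congr fun s => Finset.sum_congr rfl fun x hx => ?_
  rw [Finset.HasAntidiagonal.mem_antidiagonal] at hx
  simp only [g]
  rw [hx]

theorem left_left_comm (B : FieldSpace M) (m n : ℤ) :
    leftField (virField M c) (leftField (virField M c) B (n + 1)) (m + 1) =
      leftField (virField M c) (leftField (virField M c) B (m + 1)) (n + 1) +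
      (((m : ℂ) - n) • leftField (virField M c) B (m + n + 1) +
        (if m = -n then ((m : ℂ) ^ 3 - m) / 12 * c else 0) • B) := by
  refine ext' fun k w => ?_
  rw [mode_add, mode_add, mode_smul, mode_smul, leftField_mode, leftField_mode, leftField_mode,
    leftSum_leftField, leftSum_leftField]
  obtain ⟨N, hN⟩ := B.left_bound w k
  have hs : ∀ s : ℕ, ∑ x ∈ Finset.HasAntidiagonal.antidiagonal s,
        ((-1 : ℂ) ^ s * (binomC (m + 1) x.1 * binomC (n + 1) x.2)) •
          virOp M (m - x.1) (virOp M (n - x.2) (B.mode (k + s) w)) =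
      ∑ x ∈ Finset.HasAntidiagonal.antidiagonal s,
        ((-1 : ℂ) ^ s * (binomC (n + 1) x.1 * binomC (m + 1) x.2)) •
          virOp M (n - x.1) (virOp M (m - x.2) (B.mode (k + s) w)) +
      (((m : ℂ) - n) • (((-1) ^ s * binomC (m + n + 1) s) •
          virOp M (m + n - s) (B.mode (k + s) w)) +
        (if m + n = s then (-1) ^ s * (((m : ℂ) ^ 3 - m) / 12 * c * binomC (m + n - 1) s)
          else 0) • B.mode (k + s) w) := by
    intro s
    have hswap := Finset.Nat.sum_antidiagonal_swap (n := s) (f := fun x : ℕ × ℕ =>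
        ((-1 : ℂ) ^ s * (binomC (n + 1) x.1 * binomC (m + 1) x.2)) •
          virOp M (n - x.1) (virOp M (m - x.2) (B.mode (k + s) w)))
    rw [← hswap]
    have hterm : ∀ x ∈ Finset.HasAntidiagonal.antidiagonal s,
        ((-1 : ℂ) ^ s * (binomC (m + 1) x.1 * binomC (n + 1) x.2)) •
          virOp M (m - x.1) (virOp M (n - x.2) (B.mode (k + s) w)) =
        ((-1 : ℂ) ^ s * (binomC (n + 1) x.swap.1 * binomC (m + 1) x.swap.2)) •
          virOp M (n - x.swap.1) (virOp M (m - x.swap.2) (B.mode (k + s) w)) +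
        (((-1) ^ s * (binomC (m + 1) x.1 * binomC (n + 1) x.2 *
            (((m : ℂ) - x.1) - (n - x.2)))) • virOp M (m + n - s) (B.mode (k + s) w) +
          (if m + n = s then (-1) ^ s * (binomC (m + 1) x.1 * binomC (n + 1) x.2 *
            (((m : ℂ) - x.1) ^ 3 - (m - x.1))) / 12 * c else 0) • B.mode (k + s) w) := by
      intro x hx
      rw [Finset.HasAntidiagonal.mem_antidiagonal] at hx
      have hx' : (x.1 : ℤ) + x.2 = s := by exact_mod_cast hx
      rw [virOp_comm (c := c), smul_add, smul_add, smul_smul, smul_smul, Prod.fst_swap,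
        Prod.snd_swap, mul_comm (binomC (n + 1) x.2),
        show m - (x.1 : ℤ) + (n - x.2) = m + n - s by rw [← hx']; ring]
      have hiff : (m - (x.1 : ℤ) = -(n - x.2)) ↔ m + n = s := by omega
      simp only [hiff]
      congr 2
      · congr 1; push_cast; ring
      · congr 1
        split_ifs
        · push_cast; ring
        · ring
    rw [Finset.sum_congr rfl hterm, Finset.sum_add_distrib, Finset.sum_add_distrib,
      ← Finset.sum_smul, ← Finset.sum_smul, ← Finset.mul_sum, vandermonde_sub, smul_smul]
    congr 3
    · ring
    · split_ifs
      · rw [← Finset.sum_mul, ← Finset.sum_div, ← Finset.mul_sum, vandermonde_cube]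
        ring
      · simp
  have hcen : ∑ᶠ s : ℕ, (if m + n = (s : ℤ) then
      (-1) ^ s * (((m : ℂ) ^ 3 - m) / 12 * c * binomC (m + n - 1) s) else 0) •
        B.mode (k + s) w =
      (if m = -n then ((m : ℂ) ^ 3 - m) / 12 * c else 0) • B.mode k w := by
    rw [finsum_eq_single _ 0]
    · by_cases h : m = -n
      · have h' : m + n = ((0 : ℕ) : ℤ) := by simp; omega
        rw [if_pos h, if_pos h', binomC_zero_right]
        simp
      · have h' : ¬ m + n = ((0 : ℕ) : ℤ) := by simp; omega
        rw [if_neg h, if_neg h', zero_smul, zero_smul]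
    · intro s hs0
      split_ifs with h
      · rw [h, binomC_pred_self s hs0]; simp
      · simp
  have hb : ∀ s : ℕ, N ≤ s → ∑ x ∈ Finset.HasAntidiagonal.antidiagonal s,
        ((-1 : ℂ) ^ s * (binomC (n + 1) x.1 * binomC (m + 1) x.2)) •
          virOp M (n - x.1) (virOp M (m - x.2) (B.mode (k + s) w)) = 0 := by
    intro s hs
    rw [hN s hs]
    simp
  have hb2 : ∀ s : ℕ, N ≤ s → ((m : ℂ) - n) • (((-1) ^ s * binomC (m + n + 1) s) •
          virOp M (m + n - s) (B.mode (k + s) w)) = 0 := by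
    intro s hs
    rw [hN s hs]
    simp
  have hb3 : ∀ s : ℕ, N ≤ s → (if m + n = (s : ℤ) then
      (-1) ^ s * (((m : ℂ) ^ 3 - m) / 12 * c * binomC (m + n - 1) s) else 0) •
        B.mode (k + s) w = 0 := by
    intro s hs
    rw [hN s hs]
    simp
  rw [finsum_congr hs, finsum_add_distrib (finite_support_of_bound hb)
      (finite_support_of_bound (N := N) fun s hs => by rw [hb2 s hs, hb3 s hs, add_zero]),
    finsum_add_distrib (finite_support_of_bound hb2) (finite_support_of_bound hb3), hcen,
    leftSum, smul_finsum]
  congr 2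
  refine finsum_congr fun s => ?_
  rw [virField_mode, show m + n + 1 - (s : ℤ) - 1 = m + n - s by ring]

theorem virOp_virOp_bound (c : ℂ) [IsSmoothVir M c] (w : M) : ∃ N : ℕ, 2 ≤ N ∧
    (∀ i j : ℕ, N ≤ i + j → virOp M (j - 1) (virOp M (i - 1) w) = 0) ∧
    (∀ s : ℕ, N ≤ s → virOp M (s - 2) w = 0) := by
  obtain ⟨K, hK⟩ := IsSmoothVir.smooth c w
  refine ⟨2 * K.toNat + 4, by omega, ?_, fun s hs => hK _ (by omega)⟩
  intro i j hij
  by_cases hi : K ≤ (i : ℤ) - 1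
  · rw [hK _ hi, map_zero]
  · have h1 : K ≤ (j : ℤ) - 1 := by omega
    have h2 : K ≤ (j : ℤ) - 1 + (i - 1) := by omega
    have h3 : ¬ ((j : ℤ) - 1 = -((i : ℤ) - 1)) := by omega
    rw [virOp_comm (c := c), hK _ h1, hK _ h2, if_neg h3]
    simp

theorem rightSum_rightField (B : FieldSpace M) (m n k : ℤ) (w : M) :
    rightSum (virField M c) (rightField (virField M c) B (n + 1)) (m + 1) k w =
      ∑ᶠ s : ℕ, ∑ x ∈ Finset.HasAntidiagonal.antidiagonal s,
        ((-1 : ℂ) ^ (m + n) * (-1 : ℂ) ^ s * (binomC (m + 1) x.1 * binomC (n + 1) x.2)) •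
          B.mode (m + n + 2 + k - s) (virOp M (x.2 - 1) (virOp M (x.1 - 1) w)) := by
  obtain ⟨N, _, hN, _⟩ := virOp_virOp_bound c w
  let g : ℕ → ℕ → M := fun i j =>
    ((-1 : ℂ) ^ (m + n) * (-1 : ℂ) ^ (i + j) * (binomC (m + 1) i * binomC (n + 1) j)) •
      B.mode (m + n + 2 + k - (i + j : ℕ)) (virOp M (j - 1) (virOp M (i - 1) w))
  have hg : ∀ i j, N ≤ i + j → g i j = 0 := fun i j h => by
    simp only [g]; rw [hN _ _ h]; simp
  have h1 : rightSum (virField M c) (rightField (virField M c) B (n + 1)) (m + 1) k w =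
      ∑ᶠ i, ∑ᶠ j, g i j := by
    rw [rightSum]
    refine finsum_congr fun i => ?_
    rw [rightField_mode, rightSum, virField_mode, smul_finsum]
    refine finsum_congr fun j => ?_
    simp only [g]
    rw [smul_smul, virField_mode,
      show n + 1 + (m + 1 + k - (i : ℤ)) - j = m + n + 2 + k - (i + j : ℕ) by push_cast; ring]
    congr 1
    rw [zpow_add₀ (by norm_num : (-1 : ℂ) ≠ 0) m 1, zpow_add₀ (by norm_num : (-1 : ℂ) ≠ 0) n 1,
      zpow_add₀ (by norm_num : (-1 : ℂ) ≠ 0) m n]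
    ring
  rw [h1, finsum_finsum_antidiagonal hg]
  refine finsum_congr fun s => Finset.sum_congr rfl fun x hx => ?_
  rw [Finset.HasAntidiagonal.mem_antidiagonal] at hx
  simp only [g]
  rw [hx]

theorem right_right_comm (B : FieldSpace M) (m n : ℤ) :
    rightField (virField M c) (rightField (virField M c) B (n + 1)) (m + 1) =
      rightField (virField M c) (rightField (virField M c) B (m + 1)) (n + 1) +
      (-((m : ℂ) - n)) • rightField (virField M c) B (m + n + 1) := by
  refine ext' fun k w => ?_
  rw [mode_add, mode_smul, rightField_mode, rightField_mode, rightField_mode,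
    rightSum_rightField, rightSum_rightField]
  obtain ⟨N, hN2, hN, hN'⟩ := virOp_virOp_bound c w
  have hs : ∀ s : ℕ, ∑ x ∈ Finset.HasAntidiagonal.antidiagonal s,
        ((-1 : ℂ) ^ (m + n) * (-1 : ℂ) ^ s * (binomC (m + 1) x.1 * binomC (n + 1) x.2)) •
          B.mode (m + n + 2 + k - s) (virOp M (x.2 - 1) (virOp M (x.1 - 1) w)) =
      ∑ x ∈ Finset.HasAntidiagonal.antidiagonal s,
        ((-1 : ℂ) ^ (n + m) * (-1 : ℂ) ^ s * (binomC (n + 1) x.1 * binomC (m + 1) x.2)) •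
          B.mode (n + m + 2 + k - s) (virOp M (x.2 - 1) (virOp M (x.1 - 1) w)) +
      (-((m : ℂ) - n)) • (((-1 : ℂ) ^ (m + n) * (-1 : ℂ) ^ s *
        (binomC (m + n + 2) s - binomC (m + n + 1) s)) •
          B.mode (m + n + 2 + k - s) (virOp M (s - 2) w)) := by
    intro s
    have hswap := Finset.Nat.sum_antidiagonal_swap (n := s) (f := fun x : ℕ × ℕ =>
        ((-1 : ℂ) ^ (n + m) * (-1 : ℂ) ^ s * (binomC (n + 1) x.1 * binomC (m + 1) x.2)) •
          B.mode (n + m + 2 + k - s) (virOp M (x.2 - 1) (virOp M (x.1 - 1) w)))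
    rw [← hswap]
    have hterm : ∀ x ∈ Finset.HasAntidiagonal.antidiagonal s,
        ((-1 : ℂ) ^ (m + n) * (-1 : ℂ) ^ s * (binomC (m + 1) x.1 * binomC (n + 1) x.2)) •
          B.mode (m + n + 2 + k - s) (virOp M (x.2 - 1) (virOp M (x.1 - 1) w)) =
        ((-1 : ℂ) ^ (n + m) * (-1 : ℂ) ^ s *
          (binomC (n + 1) x.swap.1 * binomC (m + 1) x.swap.2)) •
          B.mode (n + m + 2 + k - s) (virOp M (x.swap.2 - 1) (virOp M (x.swap.1 - 1) w)) +
        ((-1 : ℂ) ^ (m + n) * (-1 : ℂ) ^ s * (binomC (m + 1) x.1 * binomC (n + 1) x.2 *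
            ((x.2 : ℂ) - x.1))) • B.mode (m + n + 2 + k - s) (virOp M (s - 2) w) := by
      intro x hx
      rw [Finset.HasAntidiagonal.mem_antidiagonal] at hx
      have hx' : (x.1 : ℤ) + x.2 = s := by exact_mod_cast hx
      have hzero : (if (x.2 : ℤ) - 1 = -((x.1 : ℤ) - 1) then
          ((((x.2 : ℤ) - 1 : ℤ) : ℂ) ^ 3 - (((x.2 : ℤ) - 1 : ℤ) : ℂ)) / 12 * c else 0) = 0 := by
        split_ifs with h
        · have h2 : x.2 = 0 ∨ x.2 = 1 ∨ x.2 = 2 := by omega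
          rcases h2 with h2 | h2 | h2 <;> rw [h2] <;> norm_num
        · rfl
      rw [virOp_comm (c := c), hzero, zero_smul, add_zero, map_add, map_smul, smul_add, smul_smul,
        Prod.fst_swap, Prod.snd_swap, mul_comm (binomC (n + 1) x.2), add_comm n m,
        show (x.2 : ℤ) - 1 + (x.1 - 1) = s - 2 by rw [← hx']; ring]
      congr 2
      push_cast
      ring
    rw [Finset.sum_congr rfl hterm, Finset.sum_add_distrib, ← Finset.sum_smul, ← Finset.mul_sum,
      vandermonde_index, smul_smul]
    congr 2
    ring
  have hb : ∀ s : ℕ, N ≤ s → ∑ x ∈ Finset.HasAntidiagonal.antidiagonal s,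
        ((-1 : ℂ) ^ (n + m) * (-1 : ℂ) ^ s * (binomC (n + 1) x.1 * binomC (m + 1) x.2)) •
          B.mode (n + m + 2 + k - s) (virOp M (x.2 - 1) (virOp M (x.1 - 1) w)) = 0 := by
    intro s hs
    refine Finset.sum_eq_zero fun x hx => ?_
    rw [Finset.HasAntidiagonal.mem_antidiagonal] at hx
    rw [hN _ _ (by omega), map_zero, smul_zero]
  have hb2 : ∀ s : ℕ, N ≤ s → (((-1 : ℂ) ^ (m + n) * (-1 : ℂ) ^ s *
        (binomC (m + n + 2) s - binomC (m + n + 1) s)) •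
          B.mode (m + n + 2 + k - s) (virOp M (s - 2) w)) = 0 := by
    intro s hs
    rw [hN' s hs, map_zero, smul_zero]
  rw [finsum_congr hs, finsum_add_distrib (finite_support_of_bound hb)
      (finite_support_of_bound (N := N) fun s hs => by rw [hb2 s hs, smul_zero])]
  congr 1
  rw [← smul_finsum]
  congr 1
  have h3 : ∀ t : ℕ, N ≤ t → ((-1 : ℂ) ^ (m + n + 1) * ((-1) ^ t * binomC (m + n + 1) t)) •
      B.mode (m + n + 1 + k - t) ((virField M c).mode t w) = 0 := by
    intro t ht
    have := hN' (t + 1) (by omega)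
    rw [show (((t + 1 : ℕ) : ℤ) - 2) = (t : ℤ) - 1 by push_cast; ring] at this
    rw [virField_mode, this, map_zero, smul_zero]
  rw [rightSum, finsum_eq_range h3, finsum_eq_range (N := N + 1) (fun s hs => hb2 s (by omega)),
    Finset.sum_range_succ']
  rw [binomC_zero_right, binomC_zero_right, sub_self, mul_zero, zero_smul, add_zero]
  refine Finset.sum_congr rfl fun t _ => ?_
  rw [show m + n + 2 = m + n + 1 + 1 by ring, binomC_pascal, virField_mode,
    show (((t + 1 : ℕ) : ℤ) - 2) = (t : ℤ) - 1 by push_cast; ring,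
    show m + n + 1 + 1 + k - ((t + 1 : ℕ) : ℤ) = m + n + 1 + k - t by push_cast; ring]
  congr 1
  rw [zpow_add₀ (by norm_num : (-1 : ℂ) ≠ 0) (m + n) 1]
  ring

/-- The operators `B ↦ L(z)_(n+1) B` on fields satisfy the Virasoro relations. -/
theorem nthProduct_virField_comm (B : FieldSpace M) (m n : ℤ) :
    nthProduct (virField M c) (m + 1) (nthProduct (virField M c) (n + 1) B) =
      nthProduct (virField M c) (n + 1) (nthProduct (virField M c) (m + 1) B) +
      (((m : ℂ) - n) • nthProduct (virField M c) (m + n + 1) B +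
        (if m = -n then ((m : ℂ) ^ 3 - m) / 12 * c else 0) • B) := by
  simp only [nthProduct_eq, leftField_sub, rightField_sub]
  rw [left_left_comm, right_right_comm, left_right_comm, left_right_comm]
  module


end FieldSpace

end VirasoroFields

section StateField

variable (M : Type*) [AddCommGroup M] [Module ℂ M] [Module UVir M] [IsScalarTower ℂ UVir M]
  (c : ℂ) [IsSmoothVir M c]

/-- The linear map with `L_n ↦ (B ↦ L(z)_(n+1) B)` and `C ↦ c`. -/
noncomputable def virFieldLin : Vir →ₗ[ℂ] Module.End ℂ (FieldSpace M) :=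
  (Finsupp.lsum ℂ fun n : ℤ => LinearMap.toSpanSingleton ℂ (Module.End ℂ (FieldSpace M))
      (FieldSpace.nthProduct (virField M c) (n + 1))).coprod
    (LinearMap.toSpanSingleton ℂ (Module.End ℂ (FieldSpace M)) (c • 1))

theorem virFieldLin_L (n : ℤ) :
    virFieldLin M c (Vir.L n) = FieldSpace.nthProduct (virField M c) (n + 1) := by
  refine (LinearMap.coprod_apply _ _ _).trans ?_
  simp [Vir.L]

theorem virFieldLin_C : virFieldLin M c Vir.C = c • 1 := by
  refine (LinearMap.coprod_apply _ _ _).trans ?_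
  simp [Vir.C]

theorem virFieldLin_lie (x y : Vir) : virFieldLin M c ⁅x, y⁆ =
    virFieldLin M c x * virFieldLin M c y - virFieldLin M c y * virFieldLin M c x := by
  let P : Vir → Submodule ℂ Vir := fun y =>
    { carrier := {x | virFieldLin M c ⁅x, y⁆ =
        virFieldLin M c x * virFieldLin M c y - virFieldLin M c y * virFieldLin M c x}
      zero_mem' := by
        change virFieldLin M c ⁅(0 : Vir), y⁆ = _
        rw [zero_lie, map_zero, zero_mul, mul_zero]
        exact (sub_self (G := Module.End ℂ (FieldSpace M)) _).symm
      add_mem' := by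
        intro a b ha hb
        change virFieldLin M c ⁅a + b, y⁆ = _
        rw [add_lie, map_add, map_add, add_mul, mul_add, ha, hb]
        abel
      smul_mem' := by
        intro s a ha
        change virFieldLin M c ⁅s • a, y⁆ = _
        rw [smul_lie, map_smul, map_smul, smul_mul_assoc, mul_smul_comm, ha]
        exact smul_sub (A := Module.End ℂ (FieldSpace M)) _ _ _ }
  have hsymm : ∀ x y, x ∈ P y → y ∈ P x := fun x y h => by
    change virFieldLin M c ⁅y, x⁆ = _
    have h' : virFieldLin M c ⁅x, y⁆ = _ := h
    rw [← lie_skew, map_neg, h']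
    exact neg_sub (α := Module.End ℂ (FieldSpace M)) _ _
  have hC : ∀ y, Vir.C ∈ P y := fun y => by
    change virFieldLin M c ⁅Vir.C, y⁆ = _
    rw [virFieldLin_C, smul_mul_assoc, mul_smul_comm, one_mul, mul_one,
      Vir.bracket_def, Vir.C_fst, map_zero, LinearMap.zero_apply, map_zero]
    exact (sub_self (G := Module.End ℂ (FieldSpace M)) _).symm
  have hLL : ∀ m n, Vir.L m ∈ P (Vir.L n) := fun m n => by
    change virFieldLin M c ⁅Vir.L m, Vir.L n⁆ = _
    rw [Vir.lie_L_L, map_add, map_smul, map_smul, virFieldLin_L, virFieldLin_L, virFieldLin_L,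
      virFieldLin_C]
    refine LinearMap.ext fun B => ?_
    simp only [LinearMap.add_apply, LinearMap.smul_apply, LinearMap.sub_apply,
      Module.End.mul_apply, Module.End.one_apply, smul_smul]
    rw [FieldSpace.nthProduct_virField_comm, add_sub_cancel_left, ite_mul, zero_mul]
  exact Vir.mem_of_generators (P y)
    (fun m => hsymm _ _ (Vir.mem_of_generators (P (Vir.L m)) (fun n => hLL n m) (hC _) y))
    (hC y) x

section

attribute [local instance] LieRing.ofAssociativeRing

/-- The action of `U(Vir)` on fields, with `L_n` acting by `B ↦ L(z)_(n+1) B` and `C` by `c`. -/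
noncomputable def uVirFieldAction : UVir →ₐ[ℂ] Module.End ℂ (FieldSpace M) :=
  UniversalEnvelopingAlgebra.lift ℂ
    { virFieldLin M c with map_lie' := fun {x y} => virFieldLin_lie M c x y }

theorem uVirFieldAction_L (n : ℤ) :
    uVirFieldAction M c (UVir.L n) = FieldSpace.nthProduct (virField M c) (n + 1) :=
  (UniversalEnvelopingAlgebra.lift_ι_apply ℂ _ _).trans (virFieldLin_L M c n)

theorem uVirFieldAction_C : uVirFieldAction M c UVir.C = c • 1 :=
  (UniversalEnvelopingAlgebra.lift_ι_apply ℂ _ _).trans (virFieldLin_C M c)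

end

theorem uVirFieldAction_one_eq_zero (u : UVir) (hu : u ∈ Submodule.span UVir
    ({UVir.C - algebraMap ℂ UVir c} ∪ {u | ∃ n : ℤ, -1 ≤ n ∧ u = UVir.L n})) :
    uVirFieldAction M c u FieldSpace.one = 0 := by
  induction hu using Submodule.span_induction with
  | mem x hx =>
    rcases hx with hx | ⟨n, hn, rfl⟩
    · rw [Set.mem_singleton_iff] at hx
      rw [hx, map_sub, uVirFieldAction_C, AlgHom.commutes, Algebra.algebraMap_eq_smul_one, sub_self]
      rfl
    · rw [uVirFieldAction_L]
      obtain ⟨k, hk⟩ : ∃ k : ℕ, n + 1 = k := ⟨(n + 1).toNat, by omega⟩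
      rw [hk, FieldSpace.nthProduct_one]
  | zero => rw [map_zero]; rfl
  | add x y _ _ hx hy => rw [map_add, LinearMap.add_apply, hx, hy, add_zero]
  | smul a x _ hx => rw [smul_eq_mul, map_mul, Module.End.mul_apply, hx, map_zero]

/-- The state-field correspondence `Y^M(·, z) : Vir^c → Hom(M, M((z)))` of a smooth module of
central charge `c`. It is the linear map with `Y(vac, z) = I_M` and
`Y(L_n v, z) = L(z)_(n+1) Y(v, z)`, so that
`Y(L_{-n_1-2} ⋯ L_{-n_r-2} vac, z) = :∂^{(n_1)} L(z) ⋯ ∂^{(n_r)} L(z):`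
(nested from the right), see `stateField_vac` and `stateField_L_smul`. -/
noncomputable def stateField : VirC c →ₗ[ℂ] FieldSpace M :=
  (Submodule.liftQ ((Submodule.span UVir
      ({UVir.C - algebraMap ℂ UVir c} ∪ {u | ∃ n : ℤ, -1 ≤ n ∧ u = UVir.L n})).restrictScalars ℂ)
    ((LinearMap.applyₗ (FieldSpace.one : FieldSpace M)) ∘ₗ (uVirFieldAction M c).toLinearMap)
    (fun u hu => uVirFieldAction_one_eq_zero M c u hu)) ∘ₗ
  (Submodule.Quotient.restrictScalarsEquiv ℂ (Submodule.span UVir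
      ({UVir.C - algebraMap ℂ UVir c} ∪
        {u | ∃ n : ℤ, -1 ≤ n ∧ u = UVir.L n}))).symm.toLinearMap

theorem stateField_mk (u : UVir) :
    stateField M c (Submodule.Quotient.mk u) = uVirFieldAction M c u FieldSpace.one := rfl

theorem stateField_vac : stateField M c (VirC.vac c) = FieldSpace.one := by
  rw [VirC.vac, stateField_mk, map_one]
  rfl

theorem stateField_L_smul (n : ℤ) (v : VirC c) :
    stateField M c (UVir.L n • v) =
      FieldSpace.nthProduct (virField M c) (n + 1) (stateField M c v) := by
  obtain ⟨u, rfl⟩ := Submodule.Quotient.mk_surjective _ v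
  rw [← Submodule.Quotient.mk_smul, stateField_mk, stateField_mk, smul_eq_mul, map_mul,
    uVirFieldAction_L]
  rfl

/-- `Y(L, z) = L(z)` for the Virasoro element `L = L_{-2} vac`. -/
theorem stateField_virasoro :
    stateField M c (UVir.L (-2) • VirC.vac c) = virField M c := by
  rw [stateField_L_smul, stateField_vac]
  exact FieldSpace.nthProduct_neg_one_one _

end StateField

section Intertwiners

variable {V M₁ M₂ M₃ : Type*} [AddCommGroup V] [Module ℂ V] [AddCommGroup M₁] [Module ℂ M₁]
  [AddCommGroup M₂] [Module ℂ M₂] [AddCommGroup M₃] [Module ℂ M₃]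

/-- Intertwining operators `𝓨(a, z) b = ∑_{n ∈ ℂ} a_(n) b z^{-n-1}` of type `(M₃; M₁ M₂)`, where
the `V`-module `M_i` is given by its fields `Y_i(v, z)`, `v ∈ V`, and its translation
operator `T_i`. -/
structure Intertwiner (Y₁ : V →ₗ[ℂ] FieldSpace M₁) (Y₂ : V →ₗ[ℂ] FieldSpace M₂)
    (Y₃ : V →ₗ[ℂ] FieldSpace M₃) (T₁ : Module.End ℂ M₁) (T₂ : Module.End ℂ M₂)
    (T₃ : Module.End ℂ M₃) where
  /-- The set of exponents: `Γ + ℤ = Γ` and `Γ / ℤ ⊆ ℂ / ℤ` is finite. -/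
  Γ : Set ℂ
  Γ_add_int : ∀ x ∈ Γ, ∀ n : ℤ, x + n ∈ Γ
  Γ_finite : ((fun x : ℂ => (x : ℂ ⧸ AddSubgroup.zmultiples (1 : ℂ))) '' Γ).Finite
  /-- The modes `a_(n) b`, `n ∈ ℂ`. -/
  mode : ℂ → M₁ →ₗ[ℂ] M₂ →ₗ[ℂ] M₃
  /-- `𝓨(a, z) b ∈ M₃[[z]] z^{-Γ}`: the exponents that occur lie in the union of finitely many sets
  `-d + ℤ_{≥ 0}` with `d ∈ Γ`. -/
  truncation : ∀ a b, ∃ D : Finset ℂ, (D : Set ℂ) ⊆ Γ ∧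
    ∀ n, mode n a b ≠ 0 → ∃ d ∈ D, ∃ i : ℕ, -n - 1 = -d + i
  /-- `[T, 𝓨(a, z)] = 𝓨(T a, z)`. -/
  translation : ∀ n a b, T₃ (mode n a b) - mode n a (T₂ b) = mode n (T₁ a) b
  /-- `𝓨(T a, z) = ∂_z 𝓨(a, z)`. -/
  derivative : ∀ n a b, mode n (T₁ a) b = (-n) • mode (n - 1) a b
  /-- The coefficient of `z₁^{-m-1} z₂^{-k-1}`, applied to `b`, in
  `ι_{z₁,z₂} (z₁ - z₂)^n Y(v, z₁) 𝓨(a, z₂) - ι_{z₂,z₁} (z₁ - z₂)^n 𝓨(a, z₂) Y(v, z₁)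
    = ∑_{i ≥ 0} 𝓨(v_(n+i) a, z₂) ∂_{z₂}^{(i)} δ(z₁, z₂)`. All sums are finite. -/
  jacobi : ∀ (v : V) (a : M₁) (b : M₂) (m n : ℤ) (k : ℂ),
    ∑ᶠ j : ℕ, ((-1) ^ j * binomC n j) •
        ((Y₃ v).mode (m + n - j) (mode (k + j) a b)
          - ((-1 : ℂ) ^ n) • mode (n + k - j) a ((Y₂ v).mode (m + j) b)) =
      ∑ᶠ j : ℕ, binomC m j • mode (m + k - j) ((Y₁ v).mode (n + j) a) b

/-- A formal series `∑_{e ∈ ℂ} f_e x^e` is given by its coefficients `f : ℂ → U`. The formal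
Fourier transform is `z^{-n-1} ↦ λ^{(n)} = λ^n / Γ(n + 1)`, where `1 / Γ` is the entire function
that vanishes at the poles of `Γ`. -/
noncomputable def formalFourier {U : Type*} [AddCommGroup U] [Module ℂ U] (f : ℂ → U) : ℂ → U :=
  fun n => (Complex.Gamma (n + 1))⁻¹ • f (-n - 1)

/-- The series `λ^{(n)} u = λ^n u / Γ(n + 1)` in `λ`. -/
noncomputable def lambdaPow {U : Type*} [AddCommGroup U] [Module ℂ U] (n : ℂ) (u : U) : ℂ → U :=
  Pi.single n ((Complex.Gamma (n + 1))⁻¹ • u)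

/-- The series `∑_{n ≥ 0} λ^{(e-n)} u_n` in `λ`. -/
noncomputable def lambdaTail {U : Type*} [AddCommGroup U] [Module ℂ U] (e : ℂ) (u : ℕ → U) :
    ℂ → U :=
  fun x => ∑ᶠ n : ℕ, lambdaPow (e - n) (u n) x

namespace Intertwiner

variable {Y₁ : V →ₗ[ℂ] FieldSpace M₁} {Y₂ : V →ₗ[ℂ] FieldSpace M₂} {Y₃ : V →ₗ[ℂ] FieldSpace M₃}
  {T₁ : Module.End ℂ M₁} {T₂ : Module.End ℂ M₂} {T₃ : Module.End ℂ M₃}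

/-- The formal series `𝓨(a, z) b`: the coefficient of `z^e` is `a_(-e-1) b`. -/
def series (I : Intertwiner Y₁ Y₂ Y₃ T₁ T₂ T₃) (a : M₁) (b : M₂) : ℂ → M₃ :=
  fun e => I.mode (-e - 1) a b

/-- The `λ`-bracket `[a_λ b] = F_z^λ (𝓨(a, z) b)`. -/
noncomputable def bracket (I : Intertwiner Y₁ Y₂ Y₃ T₁ T₂ T₃) (a : M₁) (b : M₂) : ℂ → M₃ :=
  formalFourier (I.series a b)

end Intertwiner

/-- Intertwining operators of type `(L^c_{h₃}; L^c_{h₁} L^c_{h₂})` for the universal Virasoro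
vertex algebra `Vir^c`; the translation operators are `L_{-1}`. -/
abbrev VirIntertwiner (c h₁ h₂ h₃ : ℂ) : Type :=
  Intertwiner (stateField (IrrMod c h₁) c) (stateField (IrrMod c h₂) c)
    (stateField (IrrMod c h₃) c) (virOp (IrrMod c h₁) (-1)) (virOp (IrrMod c h₂) (-1))
    (virOp (IrrMod c h₃) (-1))

/-- Highest weight vectors of `L^c_h`. -/
def IsHighestWeightVector {c h : ℂ} (a : IrrMod c h) : Prop :=
  a ≠ 0 ∧ virOp (IrrMod c h) 0 a = h • a ∧ ∀ n : ℤ, 1 ≤ n → virOp (IrrMod c h) n a = 0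

/-- The vectors of `L^c_h` of level at most `N`: the sums of eigenvectors of `L_0` with
eigenvalues `h, h + 1, …, h + N`. -/
noncomputable def levelLE (c h : ℂ) (N : ℕ) : Submodule ℂ (IrrMod c h) :=
  ⨆ i : Fin (N + 1), Module.End.eigenspace (virOp (IrrMod c h) 0) (h + ((i : ℕ) : ℂ))

/-- The central charge `c_{p,q} = 1 - 6 (p - q)² / (p q)`. -/
noncomputable def minimalC (p q : ℕ) : ℂ := 1 - 6 * ((p : ℂ) - q) ^ 2 / (p * q)

/-- The conformal weight `h_{k,l} = ((l p - k q)² - (p - q)²) / (4 p q)`. -/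
noncomputable def minimalH (p q k l : ℕ) : ℂ :=
  (((l : ℂ) * p - k * q) ^ 2 - ((p : ℂ) - q) ^ 2) / (4 * p * q)

end Intertwiners

/-! Everything rests on counting `L_0`-weights and on one commutator. The module `L^c_h` is
generated by a vector of weight `h` that the positive modes kill, so it is spanned by words in the
negative modes applied to this vector. Each such word is an `L_0`-eigenvector with eigenvalue in `h
+ ℤ_{≥0}`. This gives the first claim (`IrrMod.exists_mem_levelLE`). Since eigenspaces for different
eigenvalues are independent, it also shows that `L_0` has no eigenvalue outside `h + ℤ_{≥0}`
(`IrrMod.eq_zero_of_virOp_zero_eq`).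

For a highest weight vector `a`, the Jacobi identity for the Virasoro element gives `[L_n, a_(x)] =
((n + 1) h₁ - (n + 1 + x)) a_(n+x)` (`Intertwiner.virOp_mode`). For `n = 0` this says that `a_(x)`
raises the `L_0`-weight by `h₁ - 1 - x`. If `b` has level at most `N`, then `a_(x) b` is therefore
zero unless `x ∈ m - ℤ_{≥0}` (`Intertwiner.mode_eq_zero_of_mem_levelLE`). So `m` is the largest
exponent, in steps of one, at which `a_(x) b` can be nonzero.

Now take `n = -j - 2`. The tail may absorb every exponent in `m + j + 1 - ℤ_{≥0}`, so only the other
exponents `x` matter. For these `a_(x) b = 0`, because `j ≥ -1` makes `m - ℤ_{≥0}` part of the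
tail's exponents. The commutator then reads `a_(x) L_{-j-2} b = ((j + 1) h₁ + (x - j - 1)) a_(x-j-2)
b`. The right-hand side can be nonzero only if `x - j - 2 ∈ m - ℤ_{≥0}`, and the one such exponent
outside the tail is `x = m + j + 2`. There the coefficient is the one claimed. -/

namespace IrrMod

variable {c h : ℂ}

/-! ### Spanning words and `L_0`-eigenvalues of `L^c_h`. -/

theorem exists_smul_gen (w : IrrMod c h) : ∃ u : UVir, w = u • gen c h := by
  obtain ⟨w, rfl⟩ := Submodule.Quotient.mk_surjective _ w
  obtain ⟨u, rfl⟩ := Submodule.Quotient.mk_surjective _ w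
  refine ⟨u, ?_⟩
  change _ = Submodule.Quotient.mk (Submodule.Quotient.mk (u • 1))
  rw [smul_eq_mul, mul_one]

theorem smul_gen_eq_zero {u : UVir} (hu : u ∈ Submodule.span UVir
    ({UVir.C - algebraMap ℂ UVir c} ∪ {UVir.L 0 - algebraMap ℂ UVir h} ∪
      {u | ∃ n : ℤ, 1 ≤ n ∧ u = UVir.L n})) : u • gen c h = 0 := by
  change Submodule.Quotient.mk (Submodule.Quotient.mk (u • 1)) = 0
  rw [smul_eq_mul, mul_one, (Submodule.Quotient.mk_eq_zero _).2 hu]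
  rfl

theorem virOp_gen_of_pos {n : ℤ} (hn : 1 ≤ n) : virOp (IrrMod c h) n (gen c h) = 0 :=
  smul_gen_eq_zero (Submodule.subset_span (Or.inr ⟨n, hn, rfl⟩))

theorem virOp_zero_gen : virOp (IrrMod c h) 0 (gen c h) = h • gen c h := by
  have := smul_gen_eq_zero (c := c) (h := h) (Submodule.subset_span (Or.inl (Or.inr rfl)))
  rwa [sub_smul, algebraMap_smul, sub_eq_zero] at this

/-- The vector `L_{-n_1-1} ⋯ L_{-n_r-1} v`, where `v` is the generator. -/
noncomputable def word (c h : ℂ) (l : List ℕ) : IrrMod c h :=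
  l.foldr (fun n w => virOp (IrrMod c h) (-(n : ℤ) - 1) w) (gen c h)

theorem word_cons (n : ℕ) (l : List ℕ) :
    word c h (n :: l) = virOp (IrrMod c h) (-(n : ℤ) - 1) (word c h l) := rfl

theorem virOp_mem_span_word_of_neg (n : ℕ) {w : IrrMod c h}
    (hw : w ∈ Submodule.span ℂ (Set.range (word c h))) :
    virOp (IrrMod c h) (-(n : ℤ) - 1) w ∈ Submodule.span ℂ (Set.range (word c h)) := by
  induction hw using Submodule.span_induction with
  | mem x hx =>
    obtain ⟨l, rfl⟩ := hx
    exact Submodule.subset_span ⟨n :: l, rfl⟩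
  | zero => rw [map_zero]; exact Submodule.zero_mem _
  | add x y _ _ hx hy => rw [map_add]; exact Submodule.add_mem _ hx hy
  | smul t x _ hx => rw [map_smul]; exact Submodule.smul_mem _ _ hx

/-- A negative mode only lengthens the word. Any other mode is moved to the right, each commutator
leaving a mode on a shorter word, until it reaches the generator, where it acts by `h` or by zero.
The words are unordered, so no reordering is needed. -/
theorem virOp_word_mem_span (l : List ℕ) (n : ℤ) :
    virOp (IrrMod c h) n (word c h l) ∈ Submodule.span ℂ (Set.range (word c h)) := by
  have hneg : ∀ (l : List ℕ) (n : ℤ), n < 0 →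
      virOp (IrrMod c h) n (word c h l) ∈ Submodule.span ℂ (Set.range (word c h)) := by
    intro l n hn
    obtain ⟨k, rfl⟩ : ∃ k : ℕ, n = -(k : ℤ) - 1 := ⟨(-n - 1).toNat, by omega⟩
    exact Submodule.subset_span ⟨k :: l, rfl⟩
  induction l generalizing n with
  | nil =>
    rcases lt_trichotomy n 0 with hn | rfl | hn
    · exact hneg _ _ hn
    · change virOp (IrrMod c h) 0 (gen c h) ∈ _
      rw [virOp_zero_gen]
      exact Submodule.smul_mem _ _ (Submodule.subset_span ⟨[], rfl⟩)
    · change virOp (IrrMod c h) n (gen c h) ∈ _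
      rw [virOp_gen_of_pos (by omega)]
      exact Submodule.zero_mem _
  | cons k l ih =>
    -- The bracket produces a mode of a different index on the shorter word, so the induction
    -- hypothesis must hold for all `n`; the central term is a multiple of that word.
    rw [word_cons, virOp_comm (c := c)]
    exact Submodule.add_mem _ (virOp_mem_span_word_of_neg k (ih n))
      (Submodule.add_mem _ (Submodule.smul_mem _ _ (ih _))
        (Submodule.smul_mem _ _ (Submodule.subset_span ⟨l, rfl⟩)))

theorem mem_span_word (w : IrrMod c h) : w ∈ Submodule.span ℂ (Set.range (word c h)) := by
  obtain ⟨u, rfl⟩ := exists_smul_gen w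
  refine UVir.smul_mem_of_stable _ ?_ ?_ u _ (Submodule.subset_span ⟨[], rfl⟩)
  · intro n x hx
    change virOp (IrrMod c h) n x ∈ _
    induction hx using Submodule.span_induction with
    | mem x hx =>
      obtain ⟨l, rfl⟩ := hx
      exact virOp_word_mem_span l n
    | zero => rw [map_zero]; exact Submodule.zero_mem _
    | add x y _ _ hx hy => rw [map_add]; exact Submodule.add_mem _ hx hy
    | smul t x _ hx => rw [map_smul]; exact Submodule.smul_mem _ _ hx
  · intro x hx
    rw [IsSmoothVir.central (c := c)]
    exact Submodule.smul_mem _ _ hx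

/-- Each letter `n` stands for `L_{-n-1}`, which raises the `L_0`-weight by `n + 1`. -/
theorem exists_virOp_zero_word (l : List ℕ) :
    ∃ i : ℕ, virOp (IrrMod c h) 0 (word c h l) = (h + (i : ℂ)) • word c h l := by
  induction l with
  | nil =>
    refine ⟨0, ?_⟩
    rw [Nat.cast_zero, add_zero]
    exact virOp_zero_gen
  | cons k l ih =>
    obtain ⟨i, hi⟩ := ih
    refine ⟨i + k + 1, ?_⟩
    -- The central term is absent, since it would require `0 = k + 1`.
    rw [word_cons, virOp_comm (c := c), hi, map_smul, if_neg (by omega), zero_smul, add_zero,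
      zero_add, ← add_smul]
    congr 1
    push_cast
    ring

theorem eigenspace_le_levelLE {i N : ℕ} (hi : i ≤ N) :
    Module.End.eigenspace (virOp (IrrMod c h) 0) (h + (i : ℂ)) ≤ levelLE c h N :=
  le_iSup (fun i : Fin (N + 1) =>
    Module.End.eigenspace (virOp (IrrMod c h) 0) (h + ((i : ℕ) : ℂ))) ⟨i, by omega⟩

theorem levelLE_mono {N K : ℕ} (hNK : N ≤ K) : levelLE c h N ≤ levelLE c h K :=
  iSup_le fun i => eigenspace_le_levelLE (by omega)

/-- A vector is a finite combination of words, so the largest weight shift among them bounds its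
level. -/
theorem exists_mem_levelLE (b : IrrMod c h) : ∃ N : ℕ, b ∈ levelLE c h N := by
  induction mem_span_word b using Submodule.span_induction with
  | mem x hx =>
    obtain ⟨l, rfl⟩ := hx
    obtain ⟨i, hi⟩ := exists_virOp_zero_word (c := c) (h := h) l
    exact ⟨i, eigenspace_le_levelLE le_rfl (Module.End.mem_eigenspace_iff.2 hi)⟩
  | zero => exact ⟨0, Submodule.zero_mem _⟩
  | add x y _ _ hx hy =>
    obtain ⟨N, hN⟩ := hx
    obtain ⟨K, hK⟩ := hy
    exact ⟨max N K, Submodule.add_mem _ (levelLE_mono (le_max_left _ _) hN)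
      (levelLE_mono (le_max_right _ _) hK)⟩
  | smul t x _ hx =>
    obtain ⟨N, hN⟩ := hx
    exact ⟨N, Submodule.smul_mem _ _ hN⟩

/-- The eigenvalues of `L_0` on `L^c_h` lie in `h + ℤ_{≥ 0}`. -/
theorem eq_zero_of_virOp_zero_eq {μ : ℂ} (hμ : ∀ i : ℕ, μ ≠ h + i) {w : IrrMod c h}
    (hw : virOp (IrrMod c h) 0 w = μ • w) : w = 0 := by
  obtain ⟨N, hN⟩ := exists_mem_levelLE w
  -- Since `μ` is none of the `h + i`, the whole level space lies in the sum of the eigenspaces for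
  -- `ν ≠ μ`, which meets the eigenspace of `μ` only in zero.
  have hle : levelLE c h N ≤
      ⨆ ν, ⨆ _ : ν ≠ μ, Module.End.eigenspace (virOp (IrrMod c h) 0) ν :=
    iSup_le fun i => le_iSup₂_of_le (h + ((i : ℕ) : ℂ)) (hμ i).symm le_rfl
  exact Submodule.disjoint_def.1 ((Module.End.eigenspaces_iSupIndep (virOp (IrrMod c h) 0)) μ) w
    (Module.End.mem_eigenspace_iff.2 hw) (hle hN)

end IrrMod

/-! ### Commutators with the Virasoro modes, and vanishing of high modes. -/

namespace Intertwiner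

variable {c h₁ h₂ h₃ : ℂ} (I : VirIntertwiner c h₁ h₂ h₃)

/-- `[L_n, a_(k)] = ((n + 1) h₁ - (n + 1 + k)) a_(n+k)` for a highest weight vector `a`. -/
theorem virOp_mode {a : IrrMod c h₁} (ha : IsHighestWeightVector a) (n : ℤ) (k : ℂ)
    (b : IrrMod c h₂) :
    virOp (IrrMod c h₃) n (I.mode k a b) = I.mode k a (virOp (IrrMod c h₂) n b) +
      (((n : ℂ) + 1) * h₁ - (n + 1 + k)) • I.mode (n + k) a b := by
  -- The mode of index `n + 1` of the Virasoro field is `L_n`. The second exponent is `0`, so the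
  -- left side collapses to its `j = 0` term, the commutator.
  have H := I.jacobi (UVir.L (-2) • VirC.vac c) a b (n + 1) 0 k
  simp only [stateField_virasoro, FieldSpace.virField_mode] at H
  rw [finsum_eq_single _ 0 (fun j hj => by rw [binomC_zero_left j hj]; simp),
    -- On the right the term of index `j` involves `L_{j-1} a`. Only `L_{-1} a`, which becomes a
    -- shifted mode of `a` by the derivative axiom, and `L_0 a = h₁ a` survive.
    finsum_eq_range (N := 2) (fun j hj => by
      rw [ha.2.2 _ (by omega), map_zero, LinearMap.zero_apply, smul_zero]),
    Finset.sum_range_succ, Finset.sum_range_one] at H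
  have h1 : binomC (n + 1) 1 = n + 1 := by simp [binomC]
  simp only [binomC_zero_right, h1, Nat.cast_zero, Nat.cast_one, Int.cast_zero, Int.cast_add,
    Int.cast_one, pow_zero, zpow_zero, one_mul, one_smul, add_zero, sub_zero, zero_add, zero_sub,
    add_sub_cancel_right, sub_self, I.derivative, ha.2.1, map_smul, LinearMap.smul_apply] at H
  rw [sub_eq_iff_eq_add', show (n : ℂ) + 1 + k - 1 = n + k by ring] at H
  rw [H, smul_smul, ← add_smul]
  congr 2
  ring

/-- If `b` has weight `h₂ + i`, then `a_(x) b` satisfies the eigenvector equation for `h₂ + i + h₁ -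
1 - x`, so it is zero unless this number lies in `h₃ + ℤ_{≥0}`. -/
theorem mode_eq_zero_of_mem_levelLE {a : IrrMod c h₁} (ha : IsHighestWeightVector a) {N : ℕ}
    {b : IrrMod c h₂} (hb : b ∈ levelLE c h₂ N) {x : ℂ}
    (hx : ∀ t : ℕ, x ≠ -h₃ + (h₂ + N) + h₁ - 1 - t) : I.mode x a b = 0 := by
  -- A kernel is a subspace, so it is enough to treat single eigenvectors.
  suffices hle : levelLE c h₂ N ≤ LinearMap.ker (I.mode x a) from hle hb
  refine iSup_le fun i w hw => ?_
  rw [Module.End.mem_eigenspace_iff] at hw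
  have H := virOp_mode I ha 0 x w
  rw [hw, map_smul, Int.cast_zero, zero_add, zero_add, ← add_smul] at H
  -- If the eigenvalue were `h₃ + s`, then `x` would lie below the top exponent by `s`, plus the `N
  -- - i` by which the weight of `w` falls short of `h₂ + N`.
  refine IrrMod.eq_zero_of_virOp_zero_eq (fun s hs => hx (s + (N - i)) ?_) H
  have hi : (i : ℕ) ≤ N := by omega
  push_cast [hi]
  linear_combination -hs

end Intertwiner

/-! ### Coefficients of the tail series in `λ`. -/

theorem lambdaTail_sub_natCast {U : Type*} [AddCommGroup U] [Module ℂ U] (e : ℂ) (u : ℕ → U)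
    (n : ℕ) : lambdaTail e u (e - n) = (Complex.Gamma (e - n + 1))⁻¹ • u n := by
  -- The exponents `e - i` are pairwise distinct, so a single summand contributes.
  rw [lambdaTail, finsum_eq_single _ n fun i hi => ?_, lambdaPow, Pi.single_eq_same]
  rw [lambdaPow, Pi.single_eq_of_ne]
  simpa using hi.symm

theorem lambdaTail_of_ne {U : Type*} [AddCommGroup U] [Module ℂ U] {e x : ℂ} (u : ℕ → U)
    (hx : ∀ n : ℕ, x ≠ e - n) : lambdaTail e u x = 0 :=
  finsum_eq_zero_of_forall_eq_zero fun n => Pi.single_eq_of_ne (hx n) _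

/-! ### The leading term of the bracket. -/

namespace Intertwiner

variable {c h₁ h₂ h₃ : ℂ} (I : VirIntertwiner c h₁ h₂ h₃)

/-- The reflection `e ↦ -e - 1`, used both to index the series and in the Fourier transform, is an
involution. -/
theorem bracket_apply (a : IrrMod c h₁) (b : IrrMod c h₂) (x : ℂ) :
    I.bracket a b x = (Complex.Gamma (x + 1))⁻¹ • I.mode x a b := by
  rw [bracket, formalFourier, series, show -(-x - 1) - 1 = x by ring]

/-- The leading term of `[a_λ L_{-j-2} b]`. -/
theorem exists_bracket_virOp_eq {a : IrrMod c h₁} (ha : IsHighestWeightVector a) {N : ℕ}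
    {b : IrrMod c h₂} (hb : b ∈ levelLE c h₂ N) {m : ℂ} (hm : m = -h₃ + (h₂ + N) + h₁ - 1)
    {j : ℤ} (hj : -1 ≤ j) :
    ∃ d : ℕ → IrrMod c h₃, I.bracket a (virOp (IrrMod c h₂) (-j - 2) b) =
      lambdaPow (m + j + 2) ((((j : ℂ) + 1) * h₁ + (m + 1)) • I.mode m a b) +
      lambdaTail (m + j + 1) d := by
  subst hm
  set m := -h₃ + (h₂ + N) + h₁ - 1
  -- Away from the tail exponents `a_(x) b` vanishes, so the commutator formula moves `L_{-j-2}` off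
  -- `b` entirely.
  have hzero : ∀ x : ℂ, (∀ t : ℕ, x ≠ m + j + 1 - t) →
      I.mode x a (virOp (IrrMod c h₂) (-j - 2) b) =
        (((j : ℂ) + 1) * h₁ + (x - j - 1)) • I.mode (x - j - 2) a b := by
    intro x hx
    have h0 : I.mode x a b = 0 := mode_eq_zero_of_mem_levelLE I ha hb fun t ht => by
      -- This is where `j ≥ -1` enters: with `i = j + 1 ≥ 0`, the exponent `m - t` equals `m + j + 1
      -- - (t + i)`, a tail exponent.
      obtain ⟨i, rfl⟩ : ∃ i : ℕ, j = (i : ℤ) - 1 := ⟨(j + 1).toNat, by omega⟩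
      refine hx (t + i) ?_
      rw [ht]
      push_cast
      ring
    have H := virOp_mode I ha (-j - 2) x b
    rw [h0, map_zero, eq_comm, add_eq_zero_iff_eq_neg, ← neg_smul] at H
    rw [H, show ((-j - 2 : ℤ) : ℂ) + x = x - j - 2 by push_cast; ring]
    congr 1
    push_cast
    ring
  -- The `d_n` are the actual modes at the tail exponents, with the same factor `1 / Γ` on both
  -- sides, so the identity there is automatic.
  refine ⟨fun n => I.mode (m + j + 1 - n) a (virOp (IrrMod c h₂) (-j - 2) b), funext fun x => ?_⟩
  rw [bracket_apply, Pi.add_apply, lambdaPow]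
  by_cases hx : ∃ n : ℕ, x = m + j + 1 - n
  · obtain ⟨n, rfl⟩ := hx
    rw [lambdaTail_sub_natCast, Pi.single_eq_of_ne, zero_add]
    -- The leading exponent `m + j + 2` would be the tail exponent with `n = -1`.
    intro hn
    have : (n : ℂ) + 1 = 0 := by linear_combination -hn
    exact Nat.cast_add_one_ne_zero n this
  · push Not at hx
    rw [lambdaTail_of_ne _ hx, add_zero, hzero x hx]
    by_cases hx' : x = m + j + 2
    · subst hx'
      rw [Pi.single_eq_same, show m + j + 2 - j - 2 = m by ring,
        show m + j + 2 - j - 1 = m + 1 by ring]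
    · rw [Pi.single_eq_of_ne hx', mode_eq_zero_of_mem_levelLE I ha hb, smul_zero, smul_zero]
      -- The offset `0` would give `x = m + j + 2`, already excluded; the offset `t + 1` would give
      -- the tail exponent `m + j + 1 - t`.
      rintro (_ | t) ht
      · rw [Nat.cast_zero] at ht
        exact hx' (by linear_combination ht)
      · refine hx t ?_
        push_cast at ht
        linear_combination ht

end Intertwiner

/-! ### Specialisation to the weights `h_{k,l}` and `h_{r,s}`. -/

theorem lemma4p3 (p q k l r s : ℕ) (hpq : Nat.Coprime p q)
    (hk : 0 < k) (hkp : k < p) (hl : 0 < l) (hlq : l < q)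
    (hr : 0 < r) (hrp : r < p) (hs : 0 < s) (hsq : s < q) (h : ℂ)
    (I : VirIntertwiner (minimalC p q) (minimalH p q k l) (minimalH p q r s) h)
    (a : IrrMod (minimalC p q) (minimalH p q k l)) (ha : IsHighestWeightVector a) :
    (∀ b : IrrMod (minimalC p q) (minimalH p q r s),
      ∃ N : ℕ, b ∈ levelLE (minimalC p q) (minimalH p q r s) N) ∧
    ∀ (N : ℕ) (b : IrrMod (minimalC p q) (minimalH p q r s)),
      b ∈ levelLE (minimalC p q) (minimalH p q r s) N →
      ∀ m : ℂ, m = -h + (minimalH p q r s + N) + minimalH p q k l - 1 →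
      ∀ j : ℤ, -1 ≤ j →
        ∃ d : ℕ → IrrMod (minimalC p q) h,
          I.bracket a (virOp (IrrMod (minimalC p q) (minimalH p q r s)) (-j - 2) b) =
            lambdaPow (m + j + 2) ((((j : ℂ) + 1) * minimalH p q k l + (m + 1)) • I.mode m a b) +
            lambdaTail (m + j + 1) d := by
  exact ⟨IrrMod.exists_mem_levelLE, fun N b hb m hm j hj =>
    Intertwiner.exists_bracket_virOp_eq I ha hb hm hj⟩
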